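/- Setting. An instance of the monotone submodular matroid secretary problem (MSMSP) consists of a matroid $\mathcal M=(E,\mathcal I)$ on a finite ground set $E$ and a function $f\colon 2^E\to\mathbb R_{\ge 0}$ that is monotone ($f(S)\le f(T)$ for $S\subseteq T\subseteq E$) and submodular ($f(A\cup\{e\})-f(A)\ge f(B\cup\{e\})-f(B)$ for $A\subseteq B\subseteq E$ and $e\in E\setminus B$). A (randomized, online) algorithm knows $n=|E|$ in advance; the elements of $E$ arrive in a uniformly random order, and each of them must be irrevocably accepted or rejected upon its arrival. At every time the algorithm may query the value $f(S)$, and whether $S\in\mathcal I$, for sets $S$ of elements that have already arrived, and it learns nothing else about the instance. The set of accepted elements must always be independent. The matroid secretary problem (MSP) is the special case in which $f(S)=w(S):=\sum_{u\in S}w(u)$ for non-negative weights $w\colon E\to\mathbb R_{\ge0}$; an optimal solution of an MSP instance is an independent set of maximum weight. An algorithm for MSMSP is $c$-competitive on $\mathcal M$ if, for every non-negative monotone submodular $f$ on $E$, the expected value under $f$ of the set of elements it accepts is at least $\frac1c\max_{T\in\mathcal I}f(T)$. Theorem. Let $\mathsf{Linear}$ be an arbitrary algorithm for MSP and let $\alpha\ge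 1$. Then there exists an algorithm for MSMSP (one algorithm for all matroids) that is $16\alpha$-competitive on every matroid $\mathcal M=(E,\mathcal I)$ on which $\mathsf{Linear}$ has the following property: for every MSP instance over $\mathcal M$ there exists a random set $S\subseteq E$ such that - $S$ is always an optimal solution of the MSP instance, and - for every element $u\in E$, $\Pr[u\text{ is selected by }\mathsf{Linear}]\ge \Pr[u\in S]/\alpha$. -/

import Mathlib

open MeasureTheory
open scoped BigOperators

universe u v

/-- The finite ground set of a finite matroid, as a `Finset`. -/
noncomputable def groundFinset {U : Type u} (M : Matroid U) [M.Finite] : Finset U :=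
  M.ground_finite.toFinset

/-- The number `n = |E|` of elements of the ground set. -/
noncomputable def groundCard {U : Type u} (M : Matroid U) [M.Finite] : ℕ :=
  (groundFinset M).card

/-- An arrival order of the ground set: the element `σ i` arrives at time `i`. -/
abbrev ArrivalOrder {U : Type u} (M : Matroid U) [M.Finite] : Type u :=
  Fin (groundCard M) ≃ (groundFinset M)

/-- The elements that have arrived up to and including time `i`, in order of arrival. -/
noncomputable def arrivedList {U : Type u} {M : Matroid U} [M.Finite] (σ : ArrivalOrder M)
    (i : Fin (groundCard M)) : List U :=
  (List.ofFn (fun j : Fin (groundCard M) => (σ j : U))).take (i + 1)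

/-- What the value oracle reveals when the elements of `l` have arrived: the values of `f` on the
subsets of these elements, and nothing about any other set. -/
noncomputable def valueOracle {U : Type u} [DecidableEq U] (f : Finset U → ℝ) (l : List U) :
    Finset U → ℝ :=
  fun S => if S ⊆ l.toFinset then f S else 0

/-- What the independence oracle reveals when the elements of `l` have arrived: which subsets of
these elements are independent, and nothing about any other set. -/
def indepOracle {U : Type u} [DecidableEq U] (M : Matroid U) (l : List U) : Finset U → Prop :=
  fun S => S ⊆ l.toFinset ∧ M.Indep (S : Set U)

/-- A randomized online algorithm for secretary problems whose elements are taken from `U`.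
All its internal randomness is a random seed, drawn when it learns the number `n` of elements and
before any element arrives. Upon each arrival it decides irrevocably whether the arriving element is
accepted, on the basis of `n`, the seed, the list of the elements that have arrived so far (the
arriving element is the last one), and all that the two oracles reveal about these elements.
Its earlier decisions are determined by the same data. -/
structure OnlineAlgorithm (U : Type u) where
  /-- The space of random seeds. -/
  Seed : ℕ → Type v
  /-- Its measurable sets. -/
  seedSpace : ∀ n, MeasurableSpace (Seed n)
  /-- The distribution of the seed. -/
  law : ∀ n, Measure (Seed n)
  /-- It is a probability distribution. -/
  law_prob : ∀ n, IsProbabilityMeasure (law n)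
  /-- The decision on the element that has just arrived: `accept n ω l v I` says that it is accepted
  when the seed is `ω`, the elements of `l` have arrived, and the oracles reveal `v` and `I`. -/
  accept : ∀ n, Seed n → List U → (Finset U → ℝ) → (Finset U → Prop) → Prop
  /-- For each input, the decision is an event. -/
  measurableSet_accept : ∀ n (l : List U) (v : Finset U → ℝ) (I : Finset U → Prop),
    MeasurableSet {ω : Seed n | accept n ω l v I}

attribute [instance] OnlineAlgorithm.seedSpace OnlineAlgorithm.law_prob

namespace OnlineAlgorithm

variable {U : Type u} [DecidableEq U]

open Classical in
/-- The set of elements accepted by `A` on the instance with matroid `M` and objective `f`, when the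
elements arrive in the order `σ` and the seed is `ω`. -/
noncomputable def output (A : OnlineAlgorithm.{u, v} U) (M : Matroid U) [M.Finite]
    (f : Finset U → ℝ) (σ : ArrivalOrder M) (ω : A.Seed (groundCard M)) : Finset U :=
  (Finset.univ.filter fun i : Fin (groundCard M) =>
    A.accept (groundCard M) ω (arrivedList σ i)
      (valueOracle f (arrivedList σ i)) (indepOracle M (arrivedList σ i))).image
    fun i => (σ i : U)

/-- The probability that `A` selects the element `u`, over a uniformly random arrival order and an
independent seed. -/
noncomputable def selectProb (A : OnlineAlgorithm.{u, v} U) (M : Matroid U) [M.Finite]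
    (f : Finset U → ℝ) (u : U) : ℝ :=
  𝔼 σ : ArrivalOrder M, (A.law (groundCard M)).real {ω | u ∈ A.output M f σ ω}

/-- The expected value of the set selected by `A`, over a uniformly random arrival order and an
independent seed. -/
noncomputable def expectedValue (A : OnlineAlgorithm.{u, v} U) (M : Matroid U) [M.Finite]
    (f : Finset U → ℝ) : ℝ :=
  𝔼 σ : ArrivalOrder M, ∫ ω, f (A.output M f σ ω) ∂(A.law (groundCard M))

end OnlineAlgorithm

/-- The linear objective `S ↦ ∑ u ∈ S, w u` given by the weights `w`. -/
def linearObjective {U : Type u} (w : U → ℝ) : Finset U → ℝ :=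
  fun S => ∑ u ∈ S, w u

/-- The weights `w` are non-negative on the ground set of `M`, so that `M` and `w` form an instance
of the matroid secretary problem. -/
def IsMSPWeight {U : Type u} (M : Matroid U) (w : U → ℝ) : Prop :=
  ∀ u ∈ M.E, 0 ≤ w u

/-- On the subsets of the ground set of `M`, the function `f` is non-negative, monotone and
submodular, so that `M` and `f` form an instance of the monotone submodular matroid secretary
problem. -/
structure IsMSMSPObjective {U : Type u} [DecidableEq U] (M : Matroid U) (f : Finset U → ℝ) :
    Prop where
  nonneg : ∀ S : Finset U, (S : Set U) ⊆ M.E → 0 ≤ f S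
  monotone : ∀ S T : Finset U, S ⊆ T → (T : Set U) ⊆ M.E → f S ≤ f T
  submodular : ∀ S T : Finset U, S ⊆ T → (T : Set U) ⊆ M.E → ∀ e ∈ M.E, e ∉ T →
    f (insert e T) - f T ≤ f (insert e S) - f S

/-- `T` is an optimal (offline) solution: an independent set of maximum value. -/
def IsOptimalSolution {U : Type u} (M : Matroid U) (f : Finset U → ℝ) (T : Finset U) : Prop :=
  M.Indep (T : Set U) ∧ ∀ T' : Finset U, M.Indep (T' : Set U) → f T' ≤ f T

/-- `A` is an algorithm for the matroid secretary problem (MSP): on every instance, the set it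
accepts is always independent. -/
def IsMSPAlgorithm {U : Type u} [DecidableEq U] (A : OnlineAlgorithm.{u, v} U) : Prop :=
  ∀ (M : Matroid U) [M.Finite] (w : U → ℝ), IsMSPWeight M w →
    ∀ (σ : ArrivalOrder M) (ω : A.Seed (groundCard M)),
      M.Indep (A.output M (linearObjective w) σ ω : Set U)

/-- `A` is an algorithm for the monotone submodular matroid secretary problem (MSMSP): on every
instance, the set it accepts is always independent. -/
def IsMSMSPAlgorithm {U : Type u} [DecidableEq U] (A : OnlineAlgorithm.{u, v} U) : Prop :=
  ∀ (M : Matroid U) [M.Finite] (f : Finset U → ℝ), IsMSMSPObjective M f →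
    ∀ (σ : ArrivalOrder M) (ω : A.Seed (groundCard M)),
      M.Indep (A.output M f σ ω : Set U)

/-- On the matroid `M`, the algorithm `A` is `c`-competitive for MSMSP: its expected value is at
least a `1 / c` fraction of the value of every independent set, hence of the optimum. -/
def IsMSMSPCompetitiveOn {U : Type u} [DecidableEq U] (A : OnlineAlgorithm.{u, v} U) (c : ℝ)
    (M : Matroid U) [M.Finite] : Prop :=
  ∀ f : Finset U → ℝ, IsMSMSPObjective M f →
    ∀ T : Finset U, M.Indep (T : Set U) → 1 / c * f T ≤ A.expectedValue M f

/-- For every MSP instance over `M` there is a random set `S` that is always an optimal solution of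
the instance, and such that `A` selects every element `u` with probability at least
`Pr[u ∈ S] / α`. -/
def SelectsOptimalElementsOn {U : Type u} [DecidableEq U] (A : OnlineAlgorithm.{u, v} U) (α : ℝ)
    (M : Matroid U) [M.Finite] : Prop :=
  ∀ w : U → ℝ, IsMSPWeight M w →
    ∃ S : PMF (Finset U),
      (∀ T ∈ S.support, IsOptimalSolution M (linearObjective w) T) ∧
      ∀ u ∈ M.E, (S.toOuterMeasure {T | u ∈ T}).toReal / α ≤
        A.selectProb M (linearObjective w) u

/-! Let L be a random sample containing each element with probability 1/2. A greedy pass over the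
ground set E visits, among the elements that keep M independent, the one with the largest marginal
value f(M + x) − f(M). A sampled element then joins M; an unsampled one is discarded from the pass,
but joins S if S stays independent. The weight of an unsampled element is its marginal at its visit;
sampled elements weigh 0. Since M is built from L alone, weights can be computed online
(`weight_local`) and given to `Linear`.

An element that contributes to S is not spanned by heavier elements, so it lies in every optimal
solution (`notMem_closure_of_gain_ne_zero`, `mem_of_isOptimalSolution`) and is selected with
probability at least 1/α. By submodularity the gains over M ∪ S bound the value of the accepted
elements from below (`sum_gain_le`). It remains to bound the average total gain X.

The coin of an element is independent of the state (M, S) at its visit, so sampled and unsampled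
elements have equal averages (`sum_powerset_total_comm`). The average F of f(M) − f(∅) splits into
X, the loss Λ from measuring marginals over M ∪ S instead of M, and the part O of the elements that
do not extend S. Telescoping gives Λ ≤ X (`total_loss_le`), a rank count gives O ≤ X + Λ
(`total_offExtend_le`), so F ≤ 4X. Greedy is a 2-approximation on L (`greedy_approx`) and L keeps
half of the optimum, so the optimum is at most 4F ≤ 16X, up to f(∅).

Positive weights must be distinct, or `Linear` could favour another optimal solution. So marginals
are rounded up, by a factor of at most c = 1 + 4⁻ⁿ, to values that encode a label of the element.
The contribution D of the empty sample, a slack in Λ ≤ X − D, absorbs this error, so the constant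
stays exactly 16. -/

namespace SampleGreedy

/-! ### The greedy pass and sums along it. -/

variable {U : Type u} [DecidableEq U]

/-- The element that the greedy algorithm, holding `M`, picks next among the elements of `R`: the
one whose marginal value has the largest key, provided that this key is positive. -/
def IsNext (f : Finset U → ℝ) (I : Finset U → Prop) (key : U → ℝ → ℝ) (M R : Finset U)
    (x : U) : Prop :=
  x ∈ R ∧ I (insert x M) ∧ 0 < key x (f (insert x M) - f M) ∧
    ∀ y ∈ R, y ≠ x → I (insert y M) →
      key y (f (insert y M) - f M) < key x (f (insert x M) - f M)

theorem IsNext.unique {f : Finset U → ℝ} {I : Finset U → Prop} {key : U → ℝ → ℝ}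
    {M R : Finset U} {x y : U} (hx : IsNext f I key M R x) (hy : IsNext f I key M R y) :
    x = y := by
  by_contra h
  exact lt_asymm (hx.2.2.2 y hy.1 (Ne.symm h) hy.2.1) (hy.2.2.2 x hx.1 h hx.2.1)

open Classical in
/-- Adds `x` to `S` if this keeps `S` independent. -/
noncomputable def extend (I : Finset U → Prop) (S : Finset U) (x : U) : Finset U :=
  if x ∉ S ∧ I (insert x S) then insert x S else S

open Classical in
/-- The greedy algorithm visits the elements of `R`. A visited element is added to `M` if it belongs
to the sample `L`, and otherwise it is added to `S` if this keeps `S` independent. The result is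
the sum of `φ M S x` over the visited `x ∈ L` and of `ψ M S x` over the visited `x ∉ L`. -/
noncomputable def total (f : Finset U → ℝ) (I : Finset U → Prop) (key : U → ℝ → ℝ)
    (φ ψ : Finset U → Finset U → U → ℝ) (L M S R : Finset U) : ℝ :=
  if h : ∃ x, IsNext f I key M R x then
    if h.choose ∈ L then
      φ M S h.choose + total f I key φ ψ L (insert h.choose M) S (R.erase h.choose)
    else
      ψ M S h.choose + total f I key φ ψ L M (extend I S h.choose) (R.erase h.choose)
  else 0
termination_by R.card
decreasing_by all_goals exact Finset.card_erase_lt_of_mem h.choose_spec.1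

section

variable {f : Finset U → ℝ} {I : Finset U → Prop} {key : U → ℝ → ℝ}
  {φ ψ φ' ψ' : Finset U → Finset U → U → ℝ} {L M S R : Finset U} {x : U}

theorem total_of_not (h : ∀ x, ¬ IsNext f I key M R x) : total f I key φ ψ L M S R = 0 := by
  rw [total, dif_neg (by simpa using h)]

theorem total_of_mem (h : IsNext f I key M R x) (hx : x ∈ L) :
    total f I key φ ψ L M S R = φ M S x + total f I key φ ψ L (insert x M) S (R.erase x) := by
  have h' : ∃ x, IsNext f I key M R x := ⟨x, h⟩
  have e : h'.choose = x := h'.choose_spec.unique h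
  rw [total, dif_pos h']
  simp only [e, if_pos hx]

theorem total_of_notMem (h : IsNext f I key M R x) (hx : x ∉ L) :
    total f I key φ ψ L M S R = ψ M S x + total f I key φ ψ L M (extend I S x) (R.erase x) := by
  have h' : ∃ x, IsNext f I key M R x := ⟨x, h⟩
  have e : h'.choose = x := h'.choose_spec.unique h
  rw [total, dif_pos h']
  simp only [e, if_neg hx]

/-- Both outcomes of the coin of `x` are induction hypotheses, so statements about all samples at
once can be proved this way. -/
theorem visit_induction (f : Finset U → ℝ) (I : Finset U → Prop) (key : U → ℝ → ℝ)
    {P : Finset U → Finset U → Finset U → Prop}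
    (halt : ∀ M S R, (∀ x, ¬ IsNext f I key M R x) → P M S R)
    (step : ∀ M S R x, IsNext f I key M R x → P (insert x M) S (R.erase x) →
      P M (extend I S x) (R.erase x) → P M S R) (M S R : Finset U) : P M S R := by
  induction hn : R.card using Nat.strong_induction_on generalizing M S R with
  | _ n ih =>
    by_cases h : ∃ x, IsNext f I key M R x
    · obtain ⟨x, hx⟩ := h
      have hlt : (R.erase x).card < n := hn ▸ Finset.card_erase_lt_of_mem hx.1
      exact step M S R x hx (ih _ hlt _ _ _ rfl) (ih _ hlt _ _ _ rfl)
    · exact halt M S R (by simpa using h)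

theorem extend_of_pos (h : x ∉ S ∧ I (insert x S)) : extend I S x = insert x S := if_pos h

theorem extend_of_neg (h : ¬ (x ∉ S ∧ I (insert x S))) : extend I S x = S := if_neg h

theorem extend_subset_insert : extend I S x ⊆ insert x S := by
  unfold extend; split_ifs
  · exact subset_rfl
  · exact Finset.subset_insert _ _

theorem total_congr_sample {L' : Finset U} (h : ∀ u ∈ R, u ∈ L ↔ u ∈ L') :
    total f I key φ ψ L M S R = total f I key φ ψ L' M S R := by
  revert h
  refine visit_induction f I key (P := fun M S R => (∀ u ∈ R, u ∈ L ↔ u ∈ L') →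
    total f I key φ ψ L M S R = total f I key φ ψ L' M S R) ?_ ?_ M S R
  · intro M S R h _; rw [total_of_not h, total_of_not h]
  · intro M S R x hx h1 h2 h
    have h' : ∀ u ∈ R.erase x, u ∈ L ↔ u ∈ L' := fun u hu => h u (Finset.mem_of_mem_erase hu)
    by_cases hL : x ∈ L
    · rw [total_of_mem hx hL, total_of_mem hx ((h x hx.1).1 hL), h1 h']
    · rw [total_of_notMem hx hL, total_of_notMem hx (mt (h x hx.1).2 hL), h2 h']

theorem total_add : total f I key (fun M S x => φ M S x + φ' M S x)
    (fun M S x => ψ M S x + ψ' M S x) L M S R =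
      total f I key φ ψ L M S R + total f I key φ' ψ' L M S R := by
  refine visit_induction f I key (P := fun M S R => total f I key (fun M S x => φ M S x + φ' M S x)
    (fun M S x => ψ M S x + ψ' M S x) L M S R =
      total f I key φ ψ L M S R + total f I key φ' ψ' L M S R) ?_ ?_ M S R
  · intro M S R h; simp [total_of_not h]
  · intro M S R x hx h1 h2
    by_cases hL : x ∈ L
    · simp only [total_of_mem hx hL, h1]; ring
    · simp only [total_of_notMem hx hL, h2]; ring

theorem total_smul (c : ℝ) : total f I key (fun M S x => c * φ M S x)
    (fun M S x => c * ψ M S x) L M S R = c * total f I key φ ψ L M S R := by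
  refine visit_induction f I key (P := fun M S R => total f I key (fun M S x => c * φ M S x)
    (fun M S x => c * ψ M S x) L M S R = c * total f I key φ ψ L M S R) ?_ ?_ M S R
  · intro M S R h; simp [total_of_not h]
  · intro M S R x hx h1 h2
    by_cases hL : x ∈ L
    · simp only [total_of_mem hx hL, h1]; ring
    · simp only [total_of_notMem hx hL, h2]; ring

theorem total_mono {E : Finset U}
    (hφ : ∀ M S x, M ⊆ E → S ⊆ E → x ∈ E → φ M S x ≤ φ' M S x)
    (hψ : ∀ M S x, M ⊆ E → S ⊆ E → x ∈ E → ψ M S x ≤ ψ' M S x)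
    (hM : M ⊆ E) (hS : S ⊆ E) (hR : R ⊆ E) :
    total f I key φ ψ L M S R ≤ total f I key φ' ψ' L M S R := by
  revert hM hS hR
  refine visit_induction f I key (P := fun M S R => M ⊆ E → S ⊆ E → R ⊆ E →
    total f I key φ ψ L M S R ≤ total f I key φ' ψ' L M S R) ?_ ?_ M S R
  · intro M S R h _ _ _; simp [total_of_not h]
  · intro M S R x hx h1 h2 hM hS hR
    have hxE := hR hx.1
    have hR' : R.erase x ⊆ E := (Finset.erase_subset _ _).trans hR
    by_cases hL : x ∈ L
    · rw [total_of_mem hx hL, total_of_mem hx hL]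
      exact add_le_add (hφ _ _ _ hM hS hxE)
        (h1 (Finset.insert_subset hxE hM) hS hR')
    · rw [total_of_notMem hx hL, total_of_notMem hx hL]
      exact add_le_add (hψ _ _ _ hM hS hxE)
        (h2 hM (extend_subset_insert.trans (Finset.insert_subset hxE hS)) hR')

theorem total_zero : total f I key (fun _ _ _ => 0) (fun _ _ _ => 0) L M S R = 0 := by
  have := total_smul (f := f) (I := I) (key := key) (φ := fun _ _ _ => 0) (ψ := fun _ _ _ => 0)
    (L := L) (M := M) (S := S) (R := R) 0
  simpa using this

theorem total_of_disjoint (h : ∀ u ∈ R, u ∉ L) :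
    total f I key φ (fun _ _ _ => 0) L M S R = 0 := by
  revert h
  refine visit_induction f I key (P := fun M S R => (∀ u ∈ R, u ∉ L) →
    total f I key φ (fun _ _ _ => 0) L M S R = 0) ?_ ?_ M S R
  · intro M S R h _; exact total_of_not h
  · intro M S R x hx h1 h2 h
    rw [total_of_notMem hx (h x hx.1), h2 fun u hu => h u (Finset.mem_of_mem_erase hu), add_zero]

/-- The state (M, S) at the visit of `x` depends only on the coins of elements visited earlier, and
the coin of `x` is fair. -/
theorem sum_powerset_total_comm : ∑ L ∈ R.powerset, total f I key φ (fun _ _ _ => 0) L M S R =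
    ∑ L ∈ R.powerset, total f I key (fun _ _ _ => 0) φ L M S R := by
  refine visit_induction f I key (P := fun M S R =>
    ∑ L ∈ R.powerset, total f I key φ (fun _ _ _ => 0) L M S R =
      ∑ L ∈ R.powerset, total f I key (fun _ _ _ => 0) φ L M S R) ?_ ?_ M S R
  · intro M S R h; simp [total_of_not h]
  · intro M S R x hx h1 h2
    have key1 : ∀ φ ψ : Finset U → Finset U → U → ℝ,
        ∑ L ∈ R.powerset, total f I key φ ψ L M S R =
        ∑ L ∈ (R.erase x).powerset, (φ M S x + ψ M S x) +
        (∑ L ∈ (R.erase x).powerset, total f I key φ ψ L (insert x M) S (R.erase x) +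
        ∑ L ∈ (R.erase x).powerset, total f I key φ ψ L M (extend I S x) (R.erase x)) := by
      intro φ ψ
      -- The samples `L` and `insert x L` are paired: they take the two branches at `x`, and
      -- afterwards the coin of `x` no longer matters.
      nth_rewrite 1 [← Finset.insert_erase hx.1]
      rw [Finset.sum_powerset_insert (Finset.notMem_erase x R), ← Finset.sum_add_distrib,
        ← Finset.sum_add_distrib, ← Finset.sum_add_distrib]
      refine Finset.sum_congr rfl fun L hL => ?_
      have hxL : x ∉ L := fun h => Finset.notMem_erase x R (Finset.mem_powerset.1 hL h)
      rw [total_of_notMem hx hxL, total_of_mem hx (Finset.mem_insert_self x L),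
        total_congr_sample (L := insert x L) (L' := L)]
      · ring
      · intro u hu
        simp [Finset.ne_of_mem_erase hu]
    rw [key1, key1, h1, h2]
    simp

theorem IsNext.congr_iff {f' : Finset U → ℝ} {I' : Finset U → Prop} {key' : U → ℝ → ℝ}
    (hf : ∀ A ⊆ M ∪ R, f A = f' A) (hI : ∀ A ⊆ M ∪ R, I A ↔ I' A) (hk : ∀ u ∈ R, key u = key' u) :
    IsNext f I key M R x ↔ IsNext f' I' key' M R x := by
  have hins : ∀ y ∈ R, insert y M ⊆ M ∪ R := fun y hy =>
    Finset.insert_subset (Finset.mem_union_right _ hy) Finset.subset_union_left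
  have h0 := hf M Finset.subset_union_left
  have e : ∀ y ∈ R, key y (f (insert y M) - f M) = key' y (f' (insert y M) - f' M) := fun y hy => by
    rw [hk y hy, hf _ (hins y hy), h0]
  unfold IsNext
  refine and_congr_right fun hx => ?_
  rw [hI _ (hins x hx), e x hx]
  refine and_congr_right fun _ => and_congr_right fun _ => ?_
  refine forall_congr' fun y => forall_congr' fun hy => ?_
  rw [hI _ (hins y hy), e y hy]

/-- The pass queries only sets of elements it holds or may still visit, so oracles restricted to
arrived elements suffice. -/
theorem total_congr_oracle {f' : Finset U → ℝ} {I' : Finset U → Prop} {key' : U → ℝ → ℝ}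
    {A : Finset U} (hf : ∀ B ⊆ A, f B = f' B) (hI : ∀ B ⊆ A, I B ↔ I' B)
    (hk : ∀ u ∈ A, key u = key' u)
    (hφ : ∀ M S x, M ⊆ A → S ⊆ A → x ∈ A → φ M S x = φ' M S x)
    (hψ : ∀ M S x, M ⊆ A → S ⊆ A → x ∈ A → ψ M S x = ψ' M S x)
    (hM : M ⊆ A) (hS : S ⊆ A) (hR : R ⊆ A) :
    total f I key φ ψ L M S R = total f' I' key' φ' ψ' L M S R := by
  revert hM hS hR
  refine visit_induction f I key (P := fun M S R => M ⊆ A → S ⊆ A → R ⊆ A →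
    total f I key φ ψ L M S R = total f' I' key' φ' ψ' L M S R) ?_ ?_ M S R
  · intro M S R h hM hS hR
    have hA := Finset.union_subset hM hR
    rw [total_of_not h, total_of_not]
    intro x hx
    exact h x ((IsNext.congr_iff (fun B hB => hf B (hB.trans hA)) (fun B hB => hI B (hB.trans hA))
      (fun u hu => hk u (hR hu))).2 hx)
  · intro M S R x hx h1 h2 hM hS hR
    have hA := Finset.union_subset hM hR
    have hx' := (IsNext.congr_iff (fun B hB => hf B (hB.trans hA))
      (fun B hB => hI B (hB.trans hA)) (fun u hu => hk u (hR hu))).1 hx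
    have hxA := hR hx.1
    have hR' : R.erase x ⊆ A := (Finset.erase_subset _ _).trans hR
    have hS' : insert x S ⊆ A := Finset.insert_subset hxA hS
    by_cases hL : x ∈ L
    · rw [total_of_mem hx hL, total_of_mem hx' hL, hφ _ _ _ hM hS hxA,
        h1 (Finset.insert_subset hxA hM) hS hR']
    · have he : extend I S x = extend I' S x := by
        unfold extend; rw [hI _ hS']
      rw [total_of_notMem hx hL, total_of_notMem hx' hL, hψ _ _ _ hM hS hxA,
        h2 hM (extend_subset_insert.trans hS') hR', he]

/-! ### Weights and their dependence on the sample alone. -/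

/-- The weight of `u`: the key of its marginal value when it is visited, if it is not sampled. -/
noncomputable def weight (f : Finset U → ℝ) (I : Finset U → Prop) (key : U → ℝ → ℝ)
    (L M S R : Finset U) (u : U) : ℝ :=
  total f I key (fun _ _ _ => 0)
    (fun M _ x => if x = u then key x (f (insert x M) - f M) else 0) L M S R

theorem weight_of_not {u : U} (h : ∀ x, ¬ IsNext f I key M R x) : weight f I key L M S R u = 0 :=
  total_of_not h

theorem weight_of_mem {u : U} (h : IsNext f I key M R x) (hx : x ∈ L) :
    weight f I key L M S R u = weight f I key L (insert x M) S (R.erase x) u := by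
  rw [weight, total_of_mem h hx, zero_add, weight]

theorem weight_of_notMem {u : U} (h : IsNext f I key M R x) (hx : x ∉ L) :
    weight f I key L M S R u = (if x = u then key x (f (insert x M) - f M) else 0) +
      weight f I key L M (extend I S x) (R.erase x) u := by
  rw [weight, total_of_notMem h hx, weight]

theorem weight_eq_zero {u : U} (hu : u ∈ R → u ∈ L) : weight f I key L M S R u = 0 := by
  revert hu
  refine visit_induction f I key (P := fun M S R => (u ∈ R → u ∈ L) →
    weight f I key L M S R u = 0) ?_ ?_ M S R
  · intro M S R h _; exact weight_of_not h
  · intro M S R x hx h1 h2 hu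
    have hu' : u ∈ R.erase x → u ∈ L := fun h => hu (Finset.mem_of_mem_erase h)
    by_cases hL : x ∈ L
    · rw [weight_of_mem hx hL, h1 hu']
    · rw [weight_of_notMem hx hL, h2 hu', if_neg, add_zero]
      rintro rfl
      exact hL (hu hx.1)

/-- Positive keys of distinct elements of `E` are distinct. -/
def KeyInjOn (key : U → ℝ → ℝ) (E : Finset U) : Prop :=
  ∀ u ∈ E, ∀ v ∈ E, ∀ x y, 0 < key u x → key u x = key v y → u = v

omit [DecidableEq U] in
theorem KeyInjOn.mono {E : Finset U} (h : KeyInjOn key E) (hR : R ⊆ E) : KeyInjOn key R :=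
  fun u hu v hv => h u (hR hu) v (hR hv)

/-- A tie for the largest key would leave no next element; distinct positive keys exclude ties. -/
theorem KeyInjOn.exists_isNext (hk : KeyInjOn key R) (hx : x ∈ R) (hI : I (insert x M))
    (hpos : 0 < key x (f (insert x M) - f M)) : ∃ z, IsNext f I key M R z := by
  classical
  obtain ⟨z, hz, hmax⟩ := (R.filter fun y => I (insert y M)).exists_max_image
    (fun y => key y (f (insert y M) - f M)) ⟨x, by simp [hx, hI]⟩
  rw [Finset.mem_filter] at hz
  have hzpos := hpos.trans_le (hmax x (by simp [hx, hI]))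
  refine ⟨z, hz.1, hz.2, hzpos, fun y hy hyz hyI => ?_⟩
  refine lt_of_le_of_ne (hmax y (by simp [hy, hyI])) fun h => hyz ?_
  exact (hk z hz.1 y hy _ _ hzpos h.symm).symm

/-- Only the sample matters for the weight of an element. -/
theorem weight_local (hk : KeyInjOn key R) {u : U} (hu : u ∈ R) (S' : Finset U) :
    weight f I key L M S R u = weight f I key L M S' (insert u (R ∩ L)) u := by
  by_cases huL : u ∈ L
  · rw [weight_eq_zero fun _ => huL, weight_eq_zero fun _ => huL]
  revert hk hu S'
  refine visit_induction f I key (P := fun M S R => KeyInjOn key R → u ∈ R → ∀ S',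
    weight f I key L M S R u = weight f I key L M S' (insert u (R ∩ L)) u) ?_ ?_ M S R
  · intro M S R h hk hu S'
    rw [weight_of_not h, weight_of_not]
    intro x hx
    obtain ⟨z, hz⟩ := hk.exists_isNext
      (Finset.insert_subset hu Finset.inter_subset_left hx.1) hx.2.1 hx.2.2.1
    exact h z hz
  · intro M S R x hx h1 h2 hk hu S'
    have hk' := hk.mono (Finset.erase_subset x R)
    have hsub : insert u (R ∩ L) ⊆ R := Finset.insert_subset hu Finset.inter_subset_left
    have hnext : x ∈ insert u (R ∩ L) → IsNext f I key M (insert u (R ∩ L)) x := fun h =>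
      ⟨h, hx.2.1, hx.2.2.1, fun y hy => hx.2.2.2 y (hsub hy)⟩
    by_cases hxu : x = u
    · subst hxu
      have hn := hnext (Finset.mem_insert_self _ _)
      rw [weight_of_notMem hx huL, weight_of_notMem hn huL, weight_eq_zero (by simp),
        weight_eq_zero (by simp)]
    · have hu' : u ∈ R.erase x := Finset.mem_erase.2 ⟨Ne.symm hxu, hu⟩
      by_cases hL : x ∈ L
      · have hn := hnext (Finset.mem_insert_of_mem (Finset.mem_inter.2 ⟨hx.1, hL⟩))
        rw [weight_of_mem hx hL, weight_of_mem hn hL, h1 hk' hu' S',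
          Finset.erase_insert_of_ne (Ne.symm hxu), Finset.erase_inter]
      -- An unsampled `x ≠ u` does not change `M`, and the small pass never contains it.
      · rw [weight_of_notMem hx hL, if_neg hxu, zero_add, h2 hk' hu' S', Finset.erase_inter,
          Finset.erase_eq_of_notMem (s := R ∩ L)]
        simp [hL]

end

/-! ### Submodularity, rounded marginals and contributions to S. -/

/-- Monotonicity and submodularity on the subsets of a finite set. -/
structure MonoSubmodularOn (f : Finset U → ℝ) (E : Finset U) : Prop where
  mono : ∀ {S T : Finset U}, S ⊆ T → T ⊆ E → f S ≤ f T
  diff_anti : ∀ {S T : Finset U} {e : U}, S ⊆ T → T ⊆ E → e ∈ E →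
    f (insert e T) - f T ≤ f (insert e S) - f S

theorem _root_.IsMSMSPObjective.monoSubmodularOn {N : Matroid U} {f : Finset U → ℝ}
    (hf : IsMSMSPObjective N f) {E : Finset U} (hE : (E : Set U) = N.E) : MonoSubmodularOn f E where
  mono hST hT := hf.monotone _ _ hST (hE ▸ Finset.coe_subset.2 hT)
  diff_anti {S T e} hST hT he := by
    have hT' : (T : Set U) ⊆ N.E := hE ▸ Finset.coe_subset.2 hT
    by_cases heT : e ∈ T
    · rw [Finset.insert_eq_of_mem heT, sub_self, sub_nonneg]
      refine hf.monotone _ _ (Finset.subset_insert e S) ?_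
      rw [← hE]
      exact Finset.coe_subset.2 (Finset.insert_subset he (hST.trans hT))
    · exact hf.submodular _ _ hST hT' e (hE ▸ Finset.mem_coe.2 he) heT

theorem MonoSubmodularOn.union_diff_anti {f : Finset U → ℝ} {E A B C : Finset U}
    (hf : MonoSubmodularOn f E) (hAB : A ⊆ B) (hB : B ⊆ E) (hC : C ⊆ E) :
    f (B ∪ C) - f B ≤ f (A ∪ C) - f A := by
  induction C using Finset.induction_on with
  | empty => simp
  | insert x C hx ih =>
    obtain ⟨hxE, hC⟩ := Finset.insert_subset_iff.1 hC
    have := hf.diff_anti (Finset.union_subset_union_left (t := C) hAB)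
      (Finset.union_subset hB hC) hxE
    rw [Finset.union_insert, Finset.union_insert]
    linarith [ih hC]

/-- Each `key u` rounds non-negative reals up, by a factor of at most `c`, and distinct elements of
`E` have distinct positive keys. -/
structure IsRoundingKey (key : U → ℝ → ℝ) (c : ℝ) (E : Finset U) : Prop where
  monotone : ∀ u, Monotone (key u)
  le_key : ∀ u x, 0 ≤ x → x ≤ key u x
  key_le : ∀ u x, 0 ≤ x → key u x ≤ c * x
  injOn : KeyInjOn key E

/-- The marginal value of `x` with respect to `M`. -/
def marg (f : Finset U → ℝ) (M _S : Finset U) (x : U) : ℝ := f (insert x M) - f M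

/-- The marginal value of `x` with respect to `M ∪ S`. -/
def margUnion (f : Finset U → ℝ) (M S : Finset U) (x : U) : ℝ :=
  f (insert x (M ∪ S)) - f (M ∪ S)

open Classical in
/-- Restricts `φ` to the elements that extend `S`. -/
noncomputable def onExtend (I : Finset U → Prop) (φ : Finset U → Finset U → U → ℝ)
    (M S : Finset U) (x : U) : ℝ :=
  if x ∉ S ∧ I (insert x S) then φ M S x else 0

open Classical in
/-- Restricts `φ` to the elements that do not extend `S`. -/
noncomputable def offExtend (I : Finset U → Prop) (φ : Finset U → Finset U → U → ℝ)
    (M S : Finset U) (x : U) : ℝ :=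
  if x ∉ S ∧ I (insert x S) then 0 else φ M S x

/-- The contribution of `u` to the value of the set `S`, if `u` is added to it. -/
noncomputable def gain (f : Finset U → ℝ) (I : Finset U → Prop) (key : U → ℝ → ℝ)
    (L M S R : Finset U) (u : U) : ℝ :=
  total f I key (fun _ _ _ => 0)
    (onExtend I fun M S x => if x = u then margUnion f M S x else 0) L M S R

section

variable {f : Finset U → ℝ} {I : Finset U → Prop} {key : U → ℝ → ℝ}
  {φ ψ : Finset U → Finset U → U → ℝ} {L M S R E : Finset U} {x : U} {c : ℝ}

theorem onExtend_of_pos (h : x ∉ S ∧ I (insert x S)) : onExtend I φ M S x = φ M S x := if_pos h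

theorem onExtend_of_neg (h : ¬ (x ∉ S ∧ I (insert x S))) : onExtend I φ M S x = 0 := if_neg h

theorem offExtend_of_pos (h : x ∉ S ∧ I (insert x S)) : offExtend I φ M S x = 0 := if_pos h

theorem offExtend_of_neg (h : ¬ (x ∉ S ∧ I (insert x S))) : offExtend I φ M S x = φ M S x :=
  if_neg h

theorem gain_of_not {u : U} (h : ∀ x, ¬ IsNext f I key M R x) : gain f I key L M S R u = 0 :=
  total_of_not h

theorem gain_of_mem {u : U} (h : IsNext f I key M R x) (hx : x ∈ L) :
    gain f I key L M S R u = gain f I key L (insert x M) S (R.erase x) u := by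
  rw [gain, total_of_mem h hx, zero_add, gain]

theorem gain_of_notMem {u : U} (h : IsNext f I key M R x) (hx : x ∉ L) :
    gain f I key L M S R u =
      onExtend I (fun M S x => if x = u then margUnion f M S x else 0) M S x +
      gain f I key L M (extend I S x) (R.erase x) u := by
  rw [gain, total_of_notMem h hx, gain]

theorem gain_eq_zero {u : U} (hu : u ∈ R → u ∈ L) : gain f I key L M S R u = 0 := by
  revert hu
  refine visit_induction f I key (P := fun M S R => (u ∈ R → u ∈ L) →
    gain f I key L M S R u = 0) ?_ ?_ M S R
  · intro M S R h _; exact gain_of_not h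
  · intro M S R x hx h1 h2 hu
    have hu' : u ∈ R.erase x → u ∈ L := fun h => hu (Finset.mem_of_mem_erase h)
    by_cases hL : x ∈ L
    · rw [gain_of_mem hx hL, h1 hu']
    · have hxu : x ≠ u := by rintro rfl; exact hL (hu hx.1)
      rw [gain_of_notMem hx hL, h2 hu', add_zero, onExtend]
      simp [hxu]

theorem gain_nonneg (hf : MonoSubmodularOn f E) (hM : M ⊆ E) (hS : S ⊆ E) (hR : R ⊆ E) (u : U) :
    0 ≤ gain f I key L M S R u := by
  refine total_zero.ge.trans (total_mono (E := E) (fun _ _ _ _ _ _ => le_rfl) ?_ hM hS hR)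
  intro M S x hM hS hx
  simp only [onExtend, margUnion]
  split_ifs
  · exact sub_nonneg.2 (hf.mono (Finset.subset_insert _ _)
      (Finset.insert_subset hx (Finset.union_subset hM hS)))
  all_goals exact le_rfl

theorem sum_gain (hR : R ⊆ E) : ∑ u ∈ E, gain f I key L M S R u =
    total f I key (fun _ _ _ => 0) (onExtend I (margUnion f)) L M S R := by
  revert hR
  refine visit_induction f I key (P := fun M S R => R ⊆ E → ∑ u ∈ E, gain f I key L M S R u =
    total f I key (fun _ _ _ => 0) (onExtend I (margUnion f)) L M S R) ?_ ?_ M S R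
  · intro M S R h _; simp [gain_of_not h, total_of_not h]
  · intro M S R x hx h1 h2 hR
    have hR' : R.erase x ⊆ E := (Finset.erase_subset _ _).trans hR
    by_cases hL : x ∈ L
    · simp_rw [gain_of_mem hx hL, h1 hR', total_of_mem hx hL, zero_add]
    · simp_rw [gain_of_notMem hx hL, Finset.sum_add_distrib, h2 hR', total_of_notMem hx hL]
      congr 1
      unfold onExtend
      split_ifs
      · rw [Finset.sum_ite_eq, if_pos (hR hx.1)]
      · simp

/-- The contributions of the elements of `Q` bound the value of `Q` from below. -/
theorem sum_gain_le (hf : MonoSubmodularOn f E) (hM : M ⊆ E) (hS : S ⊆ E) (hR : R ⊆ E)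
    (Q : Finset U) :
    ∑ u ∈ Q, gain f I key L M S R u ≤ f (S ∪ (Q ∩ R)) - f S := by
  revert hM hS hR
  refine visit_induction f I key (P := fun M S R => M ⊆ E → S ⊆ E → R ⊆ E →
    ∑ u ∈ Q, gain f I key L M S R u ≤ f (S ∪ (Q ∩ R)) - f S) ?_ ?_ M S R
  · intro M S R h hM hS hR
    simp only [gain_of_not h, Finset.sum_const_zero]
    exact sub_nonneg.2 (hf.mono Finset.subset_union_left
      (Finset.union_subset hS (Finset.inter_subset_right.trans hR)))
  · intro M S R x hx h1 h2 hM hS hR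
    have hxE := hR hx.1
    have hR' : R.erase x ⊆ E := (Finset.erase_subset _ _).trans hR
    have hQR : Q ∩ R ⊆ E := Finset.inter_subset_right.trans hR
    have hQR' : Q ∩ R.erase x ⊆ E := Finset.inter_subset_right.trans hR'
    have hle : f (S ∪ (Q ∩ R.erase x)) ≤ f (S ∪ (Q ∩ R)) :=
      hf.mono (Finset.union_subset_union_right
        (Finset.inter_subset_inter_left (Finset.erase_subset _ _)))
        (Finset.union_subset hS hQR)
    by_cases hL : x ∈ L
    · simp_rw [gain_of_mem hx hL]
      linarith [h1 (Finset.insert_subset hxE hM) hS hR']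
    · simp_rw [gain_of_notMem hx hL, Finset.sum_add_distrib]
      by_cases ha : x ∉ S ∧ I (insert x S)
      · have h3 := h2 hM (extend_subset_insert.trans (Finset.insert_subset hxE hS)) hR'
        rw [extend_of_pos ha] at h3 ⊢
        simp_rw [onExtend_of_pos ha, Finset.sum_ite_eq]
        split_ifs with hxQ
        · have h4 : insert x S ∪ (Q ∩ R.erase x) = S ∪ (Q ∩ R) := by
            ext y
            by_cases hy : y = x
            · subst hy; simp [hxQ, hx.1]
            · simp [hy]
          -- The gain of `x`, measured over `M ∪ S`, is at most its marginal over `S`.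
          have h5 := hf.diff_anti (Finset.subset_union_right (s₁ := M) (s₂ := S))
            (Finset.union_subset hM hS) hxE
          rw [h4] at h3
          unfold margUnion
          linarith
        -- Here `x` joins `S` but is not in `Q`; taking it out of `S` only raises the marginal of
        -- the rest of `Q`.
        · have h5 := hf.union_diff_anti (Finset.subset_insert x S)
            (Finset.insert_subset hxE hS) hQR'
          linarith
      · have h3 := h2 hM (extend_subset_insert.trans (Finset.insert_subset hxE hS)) hR'
        rw [extend_of_neg ha] at h3 ⊢
        simp_rw [onExtend_of_neg ha, Finset.sum_const_zero]
        linarith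

theorem weight_nonneg (u : U) : 0 ≤ weight f I key L M S R u := by
  refine visit_induction f I key (P := fun M S R => 0 ≤ weight f I key L M S R u) ?_ ?_ M S R
  · intro M S R h; rw [weight_of_not h]
  · intro M S R x hx h1 h2
    by_cases hL : x ∈ L
    · rwa [weight_of_mem hx hL]
    · rw [weight_of_notMem hx hL]
      refine add_nonneg ?_ h2
      split_ifs
      exacts [hx.2.2.1.le, le_rfl]

/-- Marginals, hence keys, only fall as `M` grows, so a bound on the current keys bounds all later
weights. -/
theorem weight_le (hf : MonoSubmodularOn f E) (hkey : ∀ u, Monotone (key u))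
    (hI : ∀ A B : Finset U, A ⊆ B → I B → I A) (hM : M ⊆ E) (hR : R ⊆ E) (u : U) {K : ℝ}
    (hK0 : 0 ≤ K) (hK : ∀ y ∈ R, I (insert y M) → key y (f (insert y M) - f M) ≤ K) :
    weight f I key L M S R u ≤ K := by
  revert hM hR hK
  refine visit_induction f I key (P := fun M S R => M ⊆ E → R ⊆ E →
    (∀ y ∈ R, I (insert y M) → key y (f (insert y M) - f M) ≤ K) →
    weight f I key L M S R u ≤ K) ?_ ?_ M S R
  · intro M S R h _ _ _; rwa [weight_of_not h]
  · intro M S R x hx h1 h2 hM hR hK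
    have hxE := hR hx.1
    have hR' : R.erase x ⊆ E := (Finset.erase_subset _ _).trans hR
    by_cases hL : x ∈ L
    · rw [weight_of_mem hx hL]
      refine h1 (Finset.insert_subset hxE hM) hR' fun y hy hyI => ?_
      have hyR := Finset.mem_of_mem_erase hy
      refine (hkey y (hf.diff_anti (Finset.subset_insert x M) (Finset.insert_subset hxE hM)
        (hR hyR))).trans (hK y hyR (hI _ _ ?_ hyI))
      exact Finset.insert_subset_insert _ (Finset.subset_insert _ _)
    · rw [weight_of_notMem hx hL]
      split_ifs with hxu
      · subst hxu
        rw [weight_eq_zero (by simp), add_zero]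
        exact hK x hx.1 hx.2.1
      · rw [zero_add]
        exact h2 hM hR' fun y hy => hK y (Finset.mem_of_mem_erase hy)

/-- A positive weight is a key of the element. -/
theorem weight_eq_key {u : U} (hu : 0 < weight f I key L M S R u) :
    ∃ x, weight f I key L M S R u = key u x := by
  revert hu
  refine visit_induction f I key (P := fun M S R => 0 < weight f I key L M S R u →
    ∃ x, weight f I key L M S R u = key u x) ?_ ?_ M S R
  · intro M S R h hu; rw [weight_of_not h] at hu; exact absurd hu (lt_irrefl _)
  · intro M S R x hx h1 h2
    by_cases hL : x ∈ L
    · rwa [weight_of_mem hx hL]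
    · rw [weight_of_notMem hx hL]
      split_ifs with hxu
      · subst hxu
        intro _
        exact ⟨_, by rw [weight_eq_zero (by simp), add_zero]⟩
      · rwa [zero_add]

theorem weight_pos_of_gain_ne_zero {u : U} (hu : gain f I key L M S R u ≠ 0) :
    0 < weight f I key L M S R u := by
  revert hu
  refine visit_induction f I key (P := fun M S R => gain f I key L M S R u ≠ 0 →
    0 < weight f I key L M S R u) ?_ ?_ M S R
  · intro M S R h hu; exact absurd (gain_of_not h) hu
  · intro M S R x hx h1 h2
    by_cases hL : x ∈ L
    · rwa [weight_of_mem hx hL, gain_of_mem hx hL]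
    · rw [weight_of_notMem hx hL, gain_of_notMem hx hL]
      split_ifs with hxu
      · exact fun _ => add_pos_of_pos_of_nonneg hx.2.2.1 (weight_nonneg u)
      · rw [zero_add, onExtend]
        simpa [hxu] using h2

end

/-! ### Contributing elements belong to every optimal solution. -/

section Matroid

variable {N : Matroid U} {f : Finset U → ℝ} {key : U → ℝ → ℝ} {L M S R E : Finset U} {x : U}
  {c : ℝ}

local notation "J" => fun A : Finset U => N.Indep (A : Set U)

theorem mem_closure_of_not_extends (hS : N.Indep (S : Set U)) (hx : x ∈ N.E)
    (h : ¬ (x ∉ S ∧ N.Indep ((insert x S : Finset U) : Set U))) : x ∈ N.closure (S : Set U) := by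
  by_cases hxS : x ∈ S
  · exact N.mem_closure_of_mem' (Finset.mem_coe.2 hxS) hx
  · by_contra hcl
    refine h ⟨hxS, ?_⟩
    rw [Finset.coe_insert, hS.insert_indep_iff]
    exact Or.inl ⟨hx, hcl⟩

theorem notMem_closure_of_extends (hS : N.Indep (S : Set U))
    (h : x ∉ S ∧ N.Indep ((insert x S : Finset U) : Set U)) : x ∉ N.closure (S : Set U) := by
  obtain ⟨hxS, h⟩ := h
  rw [Finset.coe_insert, hS.insert_indep_iff] at h
  exact (h.resolve_right (by simpa using hxS)).2

theorem indep_extend (hS : N.Indep (S : Set U)) : N.Indep (extend J S x : Set U) := by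
  unfold extend
  split_ifs with h
  exacts [h.2, hS]

omit [DecidableEq U] in
theorem indep_subset (A B : Finset U) (hAB : A ⊆ B) (hB : N.Indep (B : Set U)) :
    N.Indep (A : Set U) := hB.subset (Finset.coe_subset.2 hAB)

/-- An element that is added to `S` is not spanned by the elements of larger weight. -/
theorem notMem_closure_of_gain_ne_zero (hE : (E : Set U) = N.E) (hf : MonoSubmodularOn f E)
    (hkey : ∀ u, Monotone (key u)) (hM : M ⊆ E) (hR : R ⊆ E) (hS : N.Indep (S : Set U)) {u : U}
    (hu : gain f J key L M S R u ≠ 0) :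
    u ∉ N.closure (S ∪ {v | weight f J key L M S R u < weight f J key L M S R v}) := by
  revert hM hR hS hu
  refine visit_induction f J key (P := fun M S R => M ⊆ E → R ⊆ E → N.Indep (S : Set U) →
    gain f J key L M S R u ≠ 0 →
    u ∉ N.closure (S ∪ {v | weight f J key L M S R u < weight f J key L M S R v})) ?_ ?_ M S R
  · intro M S R h _ _ _ hu; exact absurd (gain_of_not h) hu
  · intro M S R x hx h1 h2 hM hR hS hu
    have hxE := hR hx.1
    have hxN : x ∈ N.E := hE ▸ Finset.mem_coe.2 hxE
    have hR' : R.erase x ⊆ E := (Finset.erase_subset _ _).trans hR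
    by_cases hL : x ∈ L
    · simp_rw [weight_of_mem hx hL]
      rw [gain_of_mem hx hL] at hu
      exact h1 (Finset.insert_subset hxE hM) hR' hS hu
    · rw [gain_of_notMem hx hL] at hu
      by_cases hxu : x = u
      · subst hxu
        rw [gain_eq_zero (by simp), add_zero] at hu
        have ha : x ∉ S ∧ N.Indep ((insert x S : Finset U) : Set U) := by
          by_contra ha
          exact hu (onExtend_of_neg ha)
        have hw : weight f J key L M S R x = key x (f (insert x M) - f M) := by
          rw [weight_of_notMem hx hL, if_pos rfl, weight_eq_zero (by simp), add_zero]
        -- At its visit `x` has the largest key left, so nothing in the remaining pass is heavier;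
        -- what came earlier has been absorbed into the span of `S`.
        have hempty : {v | weight f J key L M S R x < weight f J key L M S R v} = ∅ := by
          rw [Set.eq_empty_iff_forall_notMem]
          intro v hv
          refine (not_lt_of_ge ?_) (Set.mem_ofPred_eq ▸ hv)
          rw [hw]
          refine weight_le hf hkey indep_subset hM hR v hx.2.2.1.le fun y hy hyI => ?_
          by_cases hyx : y = x
          · rw [hyx]
          · exact (hx.2.2.2 y hy hyx hyI).le
        rw [hempty, Set.union_empty]
        exact notMem_closure_of_extends hS ha
      · have hu' : gain f J key L M (extend J S x) (R.erase x) u ≠ 0 := by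
          rwa [onExtend, if_neg hxu, ite_self, zero_add] at hu
        have h3 := h2 hM hR' (indep_extend hS) hu'
        contrapose! h3
        set w := weight f J key L M S R with hw
        set w' := weight f J key L M (extend J S x) (R.erase x) with hw'
        have hww : ∀ v, v ≠ x → w v = w' v := fun v hv => by
          rw [hw, weight_of_notMem hx hL, if_neg (Ne.symm hv), zero_add]
        have hxS : x ∈ N.closure ((extend J S x : Finset U) : Set U) := by
          by_cases ha : x ∉ S ∧ N.Indep ((insert x S : Finset U) : Set U)
          · rw [extend_of_pos ha]
            exact N.mem_closure_of_mem' (by simp) hxN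
          · rw [extend_of_neg ha]
            exact mem_closure_of_not_extends hS hxN ha
        have hSS : (S : Set U) ⊆ (extend J S x : Finset U) := by
          unfold extend
          split_ifs
          · exact Finset.coe_subset.2 (Finset.subset_insert _ _)
          · exact subset_rfl
        -- The new `S` spans `x` whether or not `x` was added, so `x` may be dropped from the
        -- heavier elements without shrinking the closure.
        have hsub : (S : Set U) ∪ {v | w u < w v} ⊆
            insert x (((extend J S x : Finset U) : Set U) ∪ {v | w' u < w' v}) := by
          rintro v (hv | hv)
          · exact Or.inr (Or.inl (hSS hv))
          · by_cases hvx : v = x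
            · exact Or.inl hvx
            · refine Or.inr (Or.inr ?_)
              rw [Set.mem_ofPred_eq] at hv ⊢
              rwa [← hww v hvx, ← hww u (Ne.symm hxu)]
        have h4 := N.closure_subset_closure hsub h3
        rwa [Matroid.closure_insert_eq_of_mem_closure
          (N.closure_subset_closure Set.subset_union_left hxS)] at h4

/-- An element of positive weight that is not spanned by the elements of larger weight belongs to
every optimal solution, provided that positive weights are distinct. -/
theorem mem_of_isOptimalSolution {w : U → ℝ} {T : Finset U} {u : U}
    (hinj : ∀ v ∈ N.E, w v = w u → v = u) (hu : u ∈ N.E) (hpos : 0 < w u)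
    (hcl : u ∉ N.closure {v | w u < w v}) (hT : IsOptimalSolution N (linearObjective w) T) :
    u ∈ T := by
  by_contra huT
  obtain ⟨hTI, hmax⟩ := hT
  have hopt : ∀ T', N.Indep ((T' : Finset U) : Set U) → ∑ u ∈ T', w u ≤ ∑ u ∈ T, w u := hmax
  by_cases hins : N.Indep ((insert u T : Finset U) : Set U)
  · have := hopt _ hins
    rw [Finset.sum_insert huT] at this
    linarith
  · have huc : u ∈ N.closure (T : Set U) := by
      by_contra h
      apply hins
      rw [Finset.coe_insert, hTI.insert_indep_iff]
      exact Or.inl ⟨hu, h⟩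
    have hC := hTI.fundCircuit_isCircuit huc (by simpa using huT)
    -- The circuit that `u` closes in `T` cannot consist of `u` and heavier elements only.
    -- Exchanging some other `y` in it for `u` would then improve `T`.
    have hex : ∃ y ∈ N.fundCircuit u T, y ≠ u ∧ ¬ w u < w y := by
      by_contra! h
      refine hcl (N.closure_subset_closure ?_ (hC.mem_closure_sdiff_singleton_of_mem
        (N.mem_fundCircuit u T)))
      rintro y ⟨hy, hyu⟩
      exact h y hy hyu
    obtain ⟨y, hy, hyu, hwy⟩ := hex
    have hyT : y ∈ T := by
      have := N.fundCircuit_subset_insert u T hy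
      exact Finset.mem_coe.1 (this.resolve_left hyu)
    have hyE : y ∈ N.E := hTI.subset_ground (Finset.mem_coe.2 hyT)
    rw [hTI.mem_fundCircuit_iff huc (by simpa using huT)] at hy
    have hI : N.Indep ((insert u (T.erase y) : Finset U) : Set U) := by
      convert hy using 1
      ext z
      by_cases hzu : z = u
      · simp [hzu, Ne.symm hyu]
      · simp [hzu, and_comm]
    have h1 := hopt _ hI
    rw [Finset.sum_insert (by simp [huT]), ← Finset.add_sum_erase T w hyT] at h1
    have h2 : w y ≠ w u := fun h => hyu (hinj y hyE h)
    exact h2 (le_antisymm (not_lt.1 hwy) (by linarith))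

end Matroid

/-! ### Loss of the sampled elements against S. -/

section

variable {f : Finset U → ℝ} {I : Finset U → Prop} {key : U → ℝ → ℝ}
  {φ ψ : Finset U → Finset U → U → ℝ} {L M S R E : Finset U} {x : U} {c : ℝ}

theorem IsRoundingKey.notMem (hkey : IsRoundingKey key c E) (hx : IsNext f I key M R x) :
    x ∉ M := by
  intro h
  have h1 := hx.2.2.1
  rw [Finset.insert_eq_of_mem h, sub_self] at h1
  have := hkey.key_le x 0 le_rfl
  linarith

theorem marg_nonneg (hf : MonoSubmodularOn f E) (hM : M ⊆ E) (hx : x ∈ E) : 0 ≤ marg f M S x :=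
  sub_nonneg.2 (hf.mono (Finset.subset_insert _ _) (Finset.insert_subset hx hM))

theorem margUnion_le_marg (hf : MonoSubmodularOn f E) (hM : M ⊆ E) (hS : S ⊆ E) (hx : x ∈ E) :
    margUnion f M S x ≤ marg f M S x :=
  hf.diff_anti Finset.subset_union_left (Finset.union_subset hM hS) hx

theorem MonoSubmodularOn.union_le_sum (hf : MonoSubmodularOn f E) (hM : M ⊆ E) {T : Finset U}
    (hT : T ⊆ E) : f (M ∪ T) - f M ≤ ∑ y ∈ T, marg f M M y := by
  induction T using Finset.induction_on with
  | empty => simp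
  | insert x T hx ih =>
    obtain ⟨hxE, hT⟩ := Finset.insert_subset_iff.1 hT
    have := hf.diff_anti (Finset.subset_union_left (s₁ := M) (s₂ := T))
      (Finset.union_subset hM hT) hxE
    rw [Finset.union_insert, Finset.sum_insert hx, marg]
    linarith [ih hT]

/-- What the sampled elements lose against `S` is bounded by the value of `S`. -/
theorem total_loss_le (hf : MonoSubmodularOn f E) (hM : M ⊆ E) (hS : S ⊆ E) (hR : R ⊆ E) :
    total f I key (fun M S x => marg f M S x - margUnion f M S x) (fun _ _ _ => 0) L M S R ≤
      f (M ∪ S) - f M +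
        total f I key (fun _ _ _ => 0) (onExtend I (margUnion f)) L M S R := by
  -- Potential argument with f(M ∪ S) − f(M): a sampled element lowers it by exactly its loss, an
  -- element added to `S` raises it by its gain, and it ends non-negative.
  revert hM hS hR
  refine visit_induction f I key (P := fun M S R => M ⊆ E → S ⊆ E → R ⊆ E →
    total f I key (fun M S x => marg f M S x - margUnion f M S x) (fun _ _ _ => 0) L M S R ≤
      f (M ∪ S) - f M +
        total f I key (fun _ _ _ => 0) (onExtend I (margUnion f)) L M S R) ?_ ?_ M S R
  · intro M S R h hM hS _
    rw [total_of_not h, total_of_not h, add_zero]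
    exact sub_nonneg.2 (hf.mono Finset.subset_union_left (Finset.union_subset hM hS))
  · intro M S R x hx h1 h2 hM hS hR
    have hxE := hR hx.1
    have hR' : R.erase x ⊆ E := (Finset.erase_subset _ _).trans hR
    by_cases hL : x ∈ L
    · have := h1 (Finset.insert_subset hxE hM) hS hR'
      rw [total_of_mem hx hL, total_of_mem hx hL]
      rw [Finset.insert_union] at this
      simp only [marg, margUnion] at this ⊢
      linarith
    · have := h2 hM (extend_subset_insert.trans (Finset.insert_subset hxE hS)) hR'
      rw [total_of_notMem hx hL, total_of_notMem hx hL]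
      by_cases ha : x ∉ S ∧ I (insert x S)
      · rw [onExtend_of_pos ha, margUnion]
        rw [extend_of_pos ha, Finset.union_insert] at this
        rw [extend_of_pos ha]
        linarith
      · rw [onExtend_of_neg ha]
        rw [extend_of_neg ha] at this ⊢
        linarith

end

/-! ### Rank charging and the greedy approximation. -/

section Matroid

variable {N : Matroid U} {f : Finset U → ℝ} {key : U → ℝ → ℝ} {L M S R E : Finset U} {x : U}
  {c : ℝ}

local notation "J" => fun A : Finset U => N.Indep (A : Set U)

/-- The keys of the sampled elements that are spanned by `S` are bounded by the keys of `S`. -/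
theorem total_offExtend_le (hE : (E : Set U) = N.E) (hf : MonoSubmodularOn f E)
    (hkey : IsRoundingKey key c E) (hM : M ⊆ E) (hR : R ⊆ E) (hS : N.Indep (S : Set U))
    {K : ℝ} (hK0 : 0 ≤ K)
    (hK : ∀ y ∈ R, N.Indep ((insert y M : Finset U) : Set U) →
      key y (f (insert y M) - f M) ≤ K)
    {r : ℕ} (hr : N.eRk ((M ∪ S : Finset U) : Set U) ≤ ((M.card + r : ℕ) : ℕ∞)) :
    total f J key (offExtend J fun M S x => key x (marg f M S x)) (fun _ _ _ => 0) L M S R ≤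
      r * K +
        total f J key (fun _ _ _ => 0) (onExtend J fun M S x => key x (marg f M S x)) L M S R := by
  -- The budget `r` bounds rank(M ∪ S) − |M|, and `K` bounds the keys still to come. An element
  -- joining `S` pays its key for one more unit of `r`; a sampled element spanned by `S` uses one
  -- unit, worth at least its own key because keys decrease.
  revert hM hR hS K r
  refine visit_induction f J key (P := fun M S R => M ⊆ E → R ⊆ E → N.Indep (S : Set U) →
    ∀ {K : ℝ}, 0 ≤ K → (∀ y ∈ R, N.Indep ((insert y M : Finset U) : Set U) →
      key y (f (insert y M) - f M) ≤ K) →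
    ∀ {r : ℕ}, N.eRk ((M ∪ S : Finset U) : Set U) ≤ ((M.card + r : ℕ) : ℕ∞) →
    total f J key (offExtend J fun M S x => key x (marg f M S x)) (fun _ _ _ => 0) L M S R ≤
      r * K + total f J key (fun _ _ _ => 0)
        (onExtend J fun M S x => key x (marg f M S x)) L M S R) ?_ ?_ M S R
  · intro M S R h _ _ _ K hK _ r _
    rw [total_of_not h, total_of_not h, add_zero]
    positivity
  · intro M S R x hx h1 h2 hM hR hS K hK0 hK r hr
    have hxE := hR hx.1
    have hxN : x ∈ N.E := hE ▸ Finset.mem_coe.2 hxE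
    have hR' : R.erase x ⊆ E := (Finset.erase_subset _ _).trans hR
    have hcard : (insert x M).card = M.card + 1 := Finset.card_insert_of_notMem (hkey.notMem hx)
    have hk0 := hx.2.2.1
    set k := key x (f (insert x M) - f M) with hk
    have hkK : k ≤ K := hK x hx.1 hx.2.1
    have hkR : ∀ y ∈ R.erase x, N.Indep ((insert y M : Finset U) : Set U) →
        key y (f (insert y M) - f M) ≤ k := fun y hy hyI =>
      (hx.2.2.2 y (Finset.mem_of_mem_erase hy) (Finset.ne_of_mem_erase hy) hyI).le
    have hkR' : ∀ y ∈ R.erase x, N.Indep ((insert y (insert x M) : Finset U) : Set U) →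
        key y (f (insert y (insert x M)) - f (insert x M)) ≤ k := fun y hy hyI =>
      (hkey.monotone y (hf.diff_anti (Finset.subset_insert x M) (Finset.insert_subset hxE hM)
        (hR' hy))).trans (hkR y hy (indep_subset _ _
          (Finset.insert_subset_insert _ (Finset.subset_insert _ _)) hyI))
    have hrk : r * k ≤ r * K := mul_le_mul_of_nonneg_left hkK (Nat.cast_nonneg r)
    have hins : N.eRk ((insert x (M ∪ S) : Finset U) : Set U) ≤ ((M.card + r + 1 : ℕ) : ℕ∞) := by
      rw [Finset.coe_insert]
      refine (N.eRk_insert_le_add_one x _).trans ?_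
      push_cast at hr ⊢
      gcongr
    by_cases hL : x ∈ L
    · rw [total_of_mem hx hL, total_of_mem hx hL, zero_add]
      by_cases ha : x ∉ S ∧ N.Indep ((insert x S : Finset U) : Set U)
      · rw [offExtend_of_pos ha]
        have := h1 (Finset.insert_subset hxE hM) hR' hS hk0.le hkR' (r := r) (by
          rw [Finset.insert_union, hcard]
          convert hins using 2
          ring)
        linarith
      · rw [offExtend_of_neg ha]
        have hxcl : x ∈ N.closure ((M ∪ S : Finset U) : Set U) :=
          N.closure_subset_closure (by simp) (mem_closure_of_not_extends hS hxN ha)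
        have heq : N.eRk ((insert x M ∪ S : Finset U) : Set U) =
            N.eRk ((M ∪ S : Finset U) : Set U) := by
          rw [Finset.insert_union, Finset.coe_insert, ← N.eRk_closure_eq,
            N.closure_insert_eq_of_mem_closure hxcl, N.eRk_closure_eq]
        -- The budget is not exhausted: `insert x M` is independent and contained in a set of rank
        -- at most |M| + r.
        have hge : ((M.card + 1 : ℕ) : ℕ∞) ≤ ((M.card + r : ℕ) : ℕ∞) := by
          rw [← hcard, ← Set.encard_coe_eq_coe_finsetCard, ← hx.2.1.eRk_eq_encard]
          refine (N.eRk_mono ?_).trans (heq.le.trans hr)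
          exact Finset.coe_subset.2 Finset.subset_union_left
        obtain ⟨r, rfl⟩ : ∃ q, r = q + 1 := by
          rw [Nat.cast_le] at hge
          exact ⟨r - 1, by omega⟩
        have := h1 (Finset.insert_subset hxE hM) hR' hS hk0.le hkR' (r := r) (by
          rw [heq, hcard]
          convert hr using 2
          ring)
        rw [marg, ← hk]
        push_cast at hrk ⊢
        linarith
    · rw [total_of_notMem hx hL, total_of_notMem hx hL, zero_add]
      by_cases ha : x ∉ S ∧ N.Indep ((insert x S : Finset U) : Set U)
      · have := h2 hM hR' (indep_extend hS) hk0.le hkR (r := r + 1) (by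
          rw [extend_of_pos ha, Finset.union_insert]
          exact hins)
        rw [onExtend_of_pos ha, marg, ← hk]
        push_cast at this
        linarith
      · have := h2 hM hR' (indep_extend hS) hk0.le hkR (r := r) (by
          rwa [extend_of_neg ha])
        rw [onExtend_of_neg ha]
        linarith

/-- If `M + x` and `M ∪ T` are independent, then `M ∪ T + x` is independent up to the removal of at
most one element of `T`. -/
theorem exists_indep_insert_union {T : Finset U} (hxM : N.Indep ((insert x M : Finset U) : Set U))
    (hMT : N.Indep ((M ∪ T : Finset U) : Set U)) (hx : x ∉ M ∪ T) :
    N.Indep ((insert x M ∪ T : Finset U) : Set U) ∨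
      ∃ y ∈ T, N.Indep ((insert x M ∪ T.erase y : Finset U) : Set U) := by
  rw [or_iff_not_imp_left]
  intro hdep
  have hxE : x ∈ N.E := hxM.subset_ground (by simp)
  have hx' : x ∉ ((M ∪ T : Finset U) : Set U) := by simpa using hx
  have hcl : x ∈ N.closure ((M ∪ T : Finset U) : Set U) := by
    refine mem_closure_of_not_extends hMT hxE fun h => hdep ?_
    rw [Finset.insert_union]
    exact h.2
  have hC := hMT.fundCircuit_isCircuit hcl hx'
  obtain ⟨y, hy, hyM⟩ : ∃ y ∈ N.fundCircuit x ((M ∪ T : Finset U) : Set U),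
      y ∉ ((insert x M : Finset U) : Set U) := by
    by_contra! h
    exact hC.not_indep (hxM.subset h)
  have hyT : y ∈ T := by
    have := N.fundCircuit_subset_insert x _ hy
    simp only [Finset.coe_insert, Set.mem_insert_iff, Finset.mem_coe, not_or] at hyM
    have h := Finset.mem_coe.1 (this.resolve_left hyM.1)
    exact (Finset.mem_union.1 h).resolve_left hyM.2
  refine ⟨y, hyT, ?_⟩
  rw [hMT.mem_fundCircuit_iff hcl hx'] at hy
  refine hy.subset ?_
  intro z hz
  simp only [Finset.coe_insert, Set.mem_insert_iff, Finset.mem_coe, not_or] at hyM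
  simp only [Finset.insert_union, Finset.coe_insert, Finset.coe_union, Finset.coe_erase,
    Set.mem_insert_iff, Set.mem_union, Finset.mem_coe, Set.mem_sdiff,
    Set.mem_singleton_iff] at hz ⊢
  refine ⟨by tauto, ?_⟩
  rintro rfl
  tauto

/-- The greedy algorithm approximates the best independent subset of the sample. -/
theorem greedy_approx (hf : MonoSubmodularOn f E) (hkey : IsRoundingKey key c E) (hc : 1 ≤ c)
    (hM : M ⊆ E) (hR : R ⊆ E) {T : Finset U} (hTR : T ⊆ R) (hTL : T ⊆ L)
    (hT : N.Indep ((M ∪ T : Finset U) : Set U)) :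
    f (M ∪ T) - f M ≤ (1 + c) * total f J key (marg f) (fun _ _ _ => 0) L M S R := by
  revert hM hR T
  refine visit_induction f J key (P := fun M S R => M ⊆ E → R ⊆ E → ∀ {T : Finset U},
    T ⊆ R → T ⊆ L → N.Indep ((M ∪ T : Finset U) : Set U) →
    f (M ∪ T) - f M ≤ (1 + c) * total f J key (marg f) (fun _ _ _ => 0) L M S R) ?_ ?_ M S R
  · intro M S R h hM hR T hTR hTL hT
    -- When the pass stops, no element of `T` has a positive marginal, since its key would be
    -- positive too.
    rw [total_of_not h, mul_zero]
    refine (hf.union_le_sum hM (hTR.trans hR)).trans (Finset.sum_nonpos fun y hy => ?_)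
    have hyE := hR (hTR hy)
    by_contra! hpos
    obtain ⟨z, hz⟩ := (hkey.injOn.mono hR).exists_isNext (f := f) (I := J) (M := M) (hTR hy)
      (indep_subset _ _ (Finset.insert_subset (Finset.mem_union_right _ hy)
        Finset.subset_union_left) hT)
      (hpos.trans_le (hkey.le_key y _ hpos.le))
    exact h z hz
  · intro M S R x hx h1 h2 hM hR T hTR hTL hT
    have hxE := hR hx.1
    have hR' : R.erase x ⊆ E := (Finset.erase_subset _ _).trans hR
    by_cases hL : x ∈ L
    · rw [total_of_mem hx hL]
      have hM' := Finset.insert_subset hxE hM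
      have hm : 0 ≤ marg f M S x := marg_nonneg hf hM hxE
      have hcm : 0 ≤ c * marg f M S x := mul_nonneg (zero_le_one.trans hc) hm
      by_cases hxT : x ∈ T
      · have hu : insert x M ∪ T.erase x = M ∪ T := by
          ext z
          by_cases hz : z = x <;> simp [hz, hxT]
        have := h1 hM' hR' (Finset.erase_subset_erase x hTR)
          ((Finset.erase_subset _ _).trans hTL) (by rwa [hu])
        rw [hu] at this
        rw [marg] at hm hcm ⊢
        linarith
      · have hle : f (M ∪ T) ≤ f (insert x M ∪ T) :=
          hf.mono (Finset.union_subset_union_left (Finset.subset_insert _ _))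
            (Finset.union_subset hM' (hTR.trans hR))
        have hTR' : T ⊆ R.erase x := Finset.subset_erase.2 ⟨hTR, hxT⟩
        rcases exists_indep_insert_union hx.2.1 hT
          (by simp [hkey.notMem hx, hxT]) with hI | ⟨y, hyT, hI⟩
        · have := h1 hM' hR' hTR' hTL hI
          rw [marg] at hm hcm ⊢
          linarith
        -- One marginal of `x` pays for enlarging `M`. Dropping `y` costs at most the marginal of
        -- `y` over `M`, whose key is below that of `x`, hence at most `c` marginals of `x`.
        · have h3 := h1 hM' hR' ((Finset.erase_subset y _).trans hTR')
            ((Finset.erase_subset y _).trans hTL) hI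
          have hyE := hR (hTR hyT)
          have h4 := hf.diff_anti (S := M) (T := insert x M ∪ T.erase y)
            ((Finset.subset_insert x M).trans Finset.subset_union_left)
            (Finset.union_subset hM' ((Finset.erase_subset y _).trans (hTR.trans hR))) hyE
          rw [← Finset.union_insert, Finset.insert_erase hyT] at h4
          have hyx : y ≠ x := by rintro rfl; exact hxT hyT
          have h5 := hx.2.2.2 y (hTR hyT) hyx (indep_subset _ _
            (Finset.insert_subset (Finset.mem_union_right _ hyT) Finset.subset_union_left) hT)
          have h6 := hkey.le_key y _ (marg_nonneg (S := S) hf hM hyE)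
          have h7 := hkey.key_le x _ hm
          rw [marg] at hm hcm h6 h7 ⊢
          linarith
    · have hxT : x ∉ T := fun h => hL (hTL h)
      rw [total_of_notMem hx hL, zero_add]
      exact h2 hM hR' (Finset.subset_erase.2 ⟨hTR, hxT⟩) hTL hT

end Matroid

end SampleGreedy

/-! ### Construction of the rounding, and averages over samples. -/

namespace SampleGreedy

/-- Values are rounded up to powers of exp ε whose exponent is congruent to the label `k` modulo n +
1, so a positive value reveals its label. The ceiling and the shift by `k` each cost at most ε(n +
1), which is half of log c. -/
theorem exists_rounding (n : ℕ) {c : ℝ} (hc : 1 < c) : ∃ h : Fin (n + 1) → ℝ → ℝ,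
    (∀ k, Monotone (h k)) ∧ (∀ k x, 0 ≤ x → x ≤ h k x) ∧ (∀ k x, 0 ≤ x → h k x ≤ c * x) ∧
      ∀ k j x y, 0 < h k x → h k x = h j y → k = j := by
  have hn : (0 : ℝ) < n + 1 := by positivity
  set ε := Real.log c / (2 * (n + 1)) with hε
  have hε0 : 0 < ε := div_pos (Real.log_pos hc) (by positivity)
  have hεc : 2 * (ε * (n + 1)) = Real.log c := by rw [hε]; field_simp
  have hp : 0 < ε * (n + 1) := mul_pos hε0 hn
  refine ⟨fun k x => if x ≤ 0 then 0 else
    Real.exp (ε * (((n + 1 : ℤ) * ⌈Real.log x / (ε * (n + 1))⌉ + (k : ℕ) : ℤ) : ℝ)),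
    ?_, ?_, ?_, ?_⟩
  · intro k x y hxy
    dsimp only
    by_cases hx : x ≤ 0
    · rw [if_pos hx]
      split_ifs
      exacts [le_rfl, (Real.exp_pos _).le]
    · rw [if_neg hx, if_neg fun hy => hx (hxy.trans hy), Real.exp_le_exp]
      rw [not_le] at hx
      refine mul_le_mul_of_nonneg_left (Int.cast_le.2 ?_) hε0.le
      gcongr
  · intro k x hx
    dsimp only
    split_ifs with h
    · exact h
    · rw [not_le] at h
      conv_lhs => rw [← Real.exp_log h]
      rw [Real.exp_le_exp]
      have h1 := Int.le_ceil (Real.log x / (ε * (n + 1)))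
      rw [div_le_iff₀ hp] at h1
      have h2 : 0 ≤ ε * ((k : ℕ) : ℝ) := by positivity
      push_cast
      linarith
  · intro k x hx
    dsimp only
    split_ifs with h
    · rw [le_antisymm h hx, mul_zero]
    · rw [not_le] at h
      have hc0 : 0 < c := one_pos.trans hc
      rw [← Real.exp_log (mul_pos hc0 h), Real.exp_le_exp, Real.log_mul hc0.ne' h.ne', ← hεc]
      have h1 := mul_lt_mul_of_pos_right (Int.ceil_lt_add_one (Real.log x / (ε * (n + 1)))) hp
      rw [add_mul, div_mul_cancel₀ _ hp.ne'] at h1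
      have h2 : ((k : ℕ) : ℝ) ≤ n + 1 := by exact_mod_cast k.2.le
      have h3 := mul_le_mul_of_nonneg_left h2 hε0.le
      push_cast
      linarith
  · intro k j x y hpos heq
    dsimp only at hpos heq
    have hx : ¬ x ≤ 0 := fun hx => by simp [hx] at hpos
    have hy : ¬ y ≤ 0 := fun hy => by rw [if_pos hy] at heq; exact hpos.ne' heq
    rw [if_neg hx, if_neg hy, Real.exp_eq_exp] at heq
    have h1 := Int.cast_injective (mul_left_cancel₀ hε0.ne' heq)
    have h2 := congrArg (fun z : ℤ => z % (n + 1 : ℤ)) h1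
    simp only [Int.mul_add_emod_self_left] at h2
    have hk : ((k : ℕ) : ℤ) % (n + 1 : ℤ) = (k : ℕ) :=
      Int.emod_eq_of_lt (by positivity) (by exact_mod_cast k.2)
    have hj : ((j : ℕ) : ℤ) % (n + 1 : ℤ) = (j : ℕ) :=
      Int.emod_eq_of_lt (by positivity) (by exact_mod_cast j.2)
    rw [hk, hj] at h2
    exact Fin.ext (by exact_mod_cast h2)

variable {U : Type u} [DecidableEq U] {N : Matroid U} {f : Finset U → ℝ} {key : U → ℝ → ℝ}
  {E : Finset U} {c : ℝ}

local notation "J" => fun A : Finset U => N.Indep (A : Set U)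

/-- A uniformly random subset of `T` has at least half of the value of `T`, on average. -/
theorem sum_powerset_inter_ge (hf : MonoSubmodularOn f E) {T : Finset U} (hT : T ⊆ E) :
    2 ^ E.card * (f T - f ∅) ≤ 2 * ∑ L ∈ E.powerset, (f (T ∩ L) - f ∅) := by
  have h1 : ∑ L ∈ E.powerset, (f (T ∩ L) - f ∅) = ∑ L ∈ E.powerset, (f (T \ L) - f ∅) := by
    refine Finset.sum_nbij' (fun L => E \ L) (fun L => E \ L) ?_ ?_ ?_ ?_ ?_
    · intro L _; exact Finset.mem_powerset.2 Finset.sdiff_subset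
    · intro L _; exact Finset.mem_powerset.2 Finset.sdiff_subset
    · intro L hL; exact Finset.sdiff_sdiff_eq_self (Finset.mem_powerset.1 hL)
    · intro L hL; exact Finset.sdiff_sdiff_eq_self (Finset.mem_powerset.1 hL)
    · intro L _
      congr 2
      ext z
      have := @hT z
      simp only [Finset.mem_inter, Finset.mem_sdiff]
      tauto
  have h2 : ∑ L ∈ E.powerset, (f T - f ∅) ≤
      ∑ L ∈ E.powerset, ((f (T ∩ L) - f ∅) + (f (T \ L) - f ∅)) := by
    refine Finset.sum_le_sum fun L _ => ?_
    -- Subadditivity over the two halves of `T`, which are exchanged by complementing the sample.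
    have h := hf.union_diff_anti (Finset.empty_subset (T ∩ L)) (Finset.inter_subset_left.trans hT)
      (Finset.sdiff_subset.trans hT : T \ L ⊆ E)
    rw [Finset.empty_union, Finset.union_comm, Finset.sdiff_union_inter] at h
    linarith
  rw [Finset.sum_add_distrib, ← h1, Finset.sum_const, Finset.card_powerset, nsmul_eq_mul] at h2
  push_cast at h2
  linarith

/-- With an empty sample, the first visited element alone has a fraction of the optimal value. -/
theorem le_card_mul_total_empty (hf : MonoSubmodularOn f E)
    (hkey : IsRoundingKey key c E) (hc : 1 ≤ c) {T : Finset U} (hTE : T ⊆ E)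
    (hT : N.Indep (T : Set U)) :
    f T - f ∅ ≤ E.card * c *
      total f J key (fun _ _ _ => 0) (onExtend J (margUnion f)) ∅ ∅ ∅ E := by
  have hE0 : (∅ : Finset U) ⊆ E := Finset.empty_subset E
  set D := total f J key (fun _ _ _ => 0) (onExtend J (margUnion f)) ∅ ∅ ∅ E with hD
  have hD0 : 0 ≤ D := by
    rw [hD, ← sum_gain subset_rfl]
    exact Finset.sum_nonneg fun u _ => gain_nonneg hf hE0 hE0 subset_rfl u
  have key1 : ∀ y ∈ T, marg f ∅ ∅ y ≤ c * D := by
    intro y hy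
    have hyI : N.Indep ((insert y ∅ : Finset U) : Set U) :=
      indep_subset _ _ (Finset.insert_subset hy (Finset.empty_subset _)) hT
    have hm := marg_nonneg (S := ∅) hf hE0 (hTE hy)
    by_cases hpos : 0 < marg f ∅ ∅ y
    · obtain ⟨x, hx⟩ := hkey.injOn.exists_isNext (f := f) (I := J) (M := ∅) (hTE hy) hyI
        (hpos.trans_le (hkey.le_key y _ hm))
      have hle : marg f ∅ ∅ y ≤ c * marg f ∅ ∅ x := by
        refine (hkey.le_key y _ hm).trans (le_trans ?_
          (hkey.key_le x _ (marg_nonneg (S := ∅) hf hE0 hx.1)))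
        by_cases hyx : y = x
        · rw [hyx]
        · exact (hx.2.2.2 y (hTE hy) hyx hyI).le
      refine hle.trans (mul_le_mul_of_nonneg_left ?_ (zero_le_one.trans hc))
      rw [hD, ← sum_gain subset_rfl]
      refine le_trans ?_ (Finset.single_le_sum
        (fun u _ => gain_nonneg hf hE0 hE0 subset_rfl u) hx.1)
      -- The first visited element is unsampled and meets `M = S = ∅`, so its gain is its full
      -- marginal.
      rw [gain_of_notMem hx (Finset.notMem_empty x), gain_eq_zero (by simp), add_zero,
        onExtend_of_pos ⟨Finset.notMem_empty x, hx.2.1⟩, if_pos rfl, margUnion, marg,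
        Finset.union_empty]
    · exact (not_lt.1 hpos).trans (mul_nonneg (zero_le_one.trans hc) hD0)
  have h1 := hf.union_le_sum hE0 hTE
  rw [Finset.empty_union] at h1
  refine (h1.trans (Finset.sum_le_card_nsmul _ _ _ key1)).trans ?_
  rw [nsmul_eq_mul, mul_assoc]
  exact mul_le_mul_of_nonneg_right (by exact_mod_cast Finset.card_le_card hTE)
    (mul_nonneg (zero_le_one.trans hc) hD0)

/-- Sampled elements spanned by `S` are charged to the keys of `S`. Such a key is at most `c` times
the gain plus the loss of its element, and coin symmetry moves this bound back to sampled elements.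
-/
theorem sum_total_offExtend_le (hE : (E : Set U) = N.E) (hf : MonoSubmodularOn f E)
    (hkey : IsRoundingKey key c E) (hc : 1 ≤ c) :
    ∑ L ∈ E.powerset, total f J key (offExtend J (margUnion f)) (fun _ _ _ => 0) L ∅ ∅ E ≤
      c * ∑ L ∈ E.powerset,
        (total f J key (onExtend J (margUnion f)) (fun _ _ _ => 0) L ∅ ∅ E +
          total f J key (fun M S x => marg f M S x - margUnion f M S x)
            (fun _ _ _ => 0) L ∅ ∅ E) := by
  classical
  have hE0 : (∅ : Finset U) ⊆ E := Finset.empty_subset E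
  obtain ⟨K, hK0, hK⟩ : ∃ K : ℝ, 0 ≤ K ∧ ∀ y ∈ E, N.Indep ((insert y ∅ : Finset U) : Set U) →
      key y (f (insert y ∅) - f ∅) ≤ K := by
    have hnn : ∀ y ∈ E, 0 ≤ key y (f (insert y ∅) - f ∅) := fun y hy =>
      (marg_nonneg (S := ∅) hf hE0 hy).trans (hkey.le_key y _ (marg_nonneg (S := ∅) hf hE0 hy))
    exact ⟨∑ y ∈ E, key y (f (insert y ∅) - f ∅), Finset.sum_nonneg hnn, fun y hy _ =>
      Finset.single_le_sum (f := fun y => key y (f (insert y ∅) - f ∅)) hnn hy⟩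
  calc ∑ L ∈ E.powerset, total f J key (offExtend J (margUnion f)) (fun _ _ _ => 0) L ∅ ∅ E
      ≤ ∑ L ∈ E.powerset, total f J key (offExtend J fun M S x => key x (marg f M S x))
          (fun _ _ _ => 0) L ∅ ∅ E := by
        refine Finset.sum_le_sum fun L _ => total_mono (E := E) ?_ (fun _ _ _ _ _ _ => le_rfl)
          hE0 hE0 subset_rfl
        intro M S x hM hS hx
        unfold offExtend
        split_ifs
        · exact le_rfl
        · exact (margUnion_le_marg hf hM hS hx).trans
            (hkey.le_key x _ (marg_nonneg hf hM hx))
    _ ≤ ∑ L ∈ E.powerset, total f J key (fun _ _ _ => 0)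
          (onExtend J fun M S x => key x (marg f M S x)) L ∅ ∅ E := by
        refine Finset.sum_le_sum fun L _ => ?_
        -- The initial budget is `r = 0`, so only the existence of `K` matters.
        have := total_offExtend_le (L := L) hE hf hkey hE0 subset_rfl (S := ∅) (by simp) hK0 hK
          (r := 0) (by simp)
        simpa using this
    _ ≤ ∑ L ∈ E.powerset, total f J key (fun _ _ _ => 0)
          (fun M S x => c * (onExtend J (margUnion f) M S x +
            (marg f M S x - margUnion f M S x))) L ∅ ∅ E := by
        refine Finset.sum_le_sum fun L _ => total_mono (E := E) (fun _ _ _ _ _ _ => le_rfl) ?_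
          hE0 hE0 subset_rfl
        intro M S x hM hS hx
        have hm := marg_nonneg (S := S) hf hM hx
        have hmu := margUnion_le_marg hf hM hS hx
        unfold onExtend
        split_ifs
        · rw [add_sub_cancel]
          exact hkey.key_le x _ hm
        · rw [zero_add]
          exact mul_nonneg (zero_le_one.trans hc) (sub_nonneg.2 hmu)
    _ = _ := by
        rw [← sum_powerset_total_comm, Finset.mul_sum]
        refine Finset.sum_congr rfl fun L _ => ?_
        rw [← total_add, ← total_smul]
        simp

/-- The average value of the contributions, compared with the optimum. -/
theorem sum_gain_ge (hE : (E : Set U) = N.E) (hf : MonoSubmodularOn f E)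
    (hkey : IsRoundingKey key c E) (hc : 1 ≤ c) (hc2 : c ≤ 2)
    (hcE : (c - 1) * (2 ^ E.card * E.card) ≤ 1) {T : Finset U} (hT : N.Indep (T : Set U)) :
    2 ^ E.card * (f T - f ∅) ≤
      16 * ∑ L ∈ E.powerset, ∑ u ∈ E, gain f J key L ∅ ∅ E u := by
  have hE0 : (∅ : Finset U) ⊆ E := Finset.empty_subset E
  have hTE : T ⊆ E := Finset.coe_subset.1 (hE ▸ hT.subset_ground)
  simp_rw [sum_gain (subset_refl E)]
  set X := ∑ L ∈ E.powerset,
    total f J key (fun _ _ _ => 0) (onExtend J (margUnion f)) L ∅ ∅ E with hX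
  set D := total f J key (fun _ _ _ => 0) (onExtend J (margUnion f)) ∅ ∅ ∅ E with hD
  set F := ∑ L ∈ E.powerset, total f J key (marg f) (fun _ _ _ => 0) L ∅ ∅ E with hF
  set Λ := ∑ L ∈ E.powerset, total f J key (fun M S x => marg f M S x - margUnion f M S x)
    (fun _ _ _ => 0) L ∅ ∅ E with hΛ
  set O := ∑ L ∈ E.powerset,
    total f J key (offExtend J (margUnion f)) (fun _ _ _ => 0) L ∅ ∅ E with hO
  have hXin : ∑ L ∈ E.powerset,
      total f J key (onExtend J (margUnion f)) (fun _ _ _ => 0) L ∅ ∅ E = X :=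
    sum_powerset_total_comm
  have hFsum : F = X + Λ + O := by
    rw [← hXin, hF, hΛ, hO, ← Finset.sum_add_distrib, ← Finset.sum_add_distrib]
    refine Finset.sum_congr rfl fun L _ => ?_
    rw [← total_add, ← total_add]
    congr 1
    · funext M S x
      unfold onExtend offExtend
      split_ifs <;> ring
    · simp
  have hOle : O ≤ c * (X + Λ) := by
    have := sum_total_offExtend_le hE hf hkey hc
    rwa [Finset.sum_add_distrib, hXin] at this
  -- The empty sample has no loss, so its whole contribution `D` remains as slack.
  have hΛle : Λ ≤ X - D := by
    have h0 : total f J key (fun M S x => marg f M S x - margUnion f M S x)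
        (fun _ _ _ => 0) ∅ ∅ ∅ E = 0 := total_of_disjoint fun u _ => Finset.notMem_empty u
    have := Finset.single_le_sum (f := fun L => total f J key (fun _ _ _ => 0)
      (onExtend J (margUnion f)) L ∅ ∅ E - total f J key
        (fun M S x => marg f M S x - margUnion f M S x) (fun _ _ _ => 0) L ∅ ∅ E)
      (s := E.powerset) (fun L _ => ?_) (Finset.empty_mem_powerset E)
    · rw [Finset.sum_sub_distrib, h0] at this
      linarith
    · have := total_loss_le (I := J) (key := key) (L := L) hf hE0 hE0 (subset_refl E)
      simp only [Finset.union_empty, sub_self, zero_add] at this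
      exact sub_nonneg.2 this
  have hV : f T - f ∅ ≤ E.card * c * D := le_card_mul_total_empty hf hkey hc hTE hT
  -- The factor 2 comes from sampling half of `T`, the factor 1 + c from greedy.
  have hVF : 2 ^ E.card * (f T - f ∅) ≤ 2 * ((1 + c) * F) := by
    refine (sum_powerset_inter_ge hf hTE).trans ?_
    refine mul_le_mul_of_nonneg_left ?_ zero_le_two
    rw [hF, Finset.mul_sum]
    refine Finset.sum_le_sum fun L _ => ?_
    have := greedy_approx (L := L) (S := ∅) hf hkey hc hE0 subset_rfl (T := T ∩ L)
      (Finset.inter_subset_left.trans hTE) Finset.inter_subset_right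
      (by
        rw [Finset.empty_union]
        exact indep_subset _ _ Finset.inter_subset_left hT)
    rwa [Finset.empty_union] at this
  set V := f T - f ∅ with hVdef
  set p : ℝ := 2 ^ E.card with hp
  have hp0 : 0 ≤ p := by positivity
  have hV0 : 0 ≤ V := sub_nonneg.2 (hf.mono (Finset.empty_subset T) hTE)
  -- F ≤ (1 + c)(X + Λ) ≤ (1 + c)(2X − D).
  have hFX : F ≤ (2 + 2 * c) * X - (1 + c) * D := by nlinarith
  have hD0 : 0 ≤ D := by
    rw [hD, ← sum_gain subset_rfl]
    exact Finset.sum_nonneg fun u _ => gain_nonneg hf hE0 hE0 subset_rfl u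
  -- The rounding error, measured against the optimum, is below the slack, because c − 1 is tiny
  -- compared with 1 / (2ⁿ n).
  have hδ : (c - 1) * (p * V) ≤ 2 * D := by
    have h1 : (c - 1) * (p * V) ≤ (c - 1) * (p * (E.card * c * D)) := by
      have := sub_nonneg.2 hc
      gcongr
    have h2 : (c - 1) * (p * (E.card * c * D)) = ((c - 1) * (p * E.card)) * (c * D) := by ring
    have h3 : ((c - 1) * (p * E.card)) * (c * D) ≤ 1 * (c * D) := by gcongr
    have h4 : c * D ≤ 2 * D := by gcongr
    linarith
  have hpV : 0 ≤ p * V := mul_nonneg hp0 hV0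
  have h5 : p * V ≤ (1 + c) ^ 2 * (4 * X - 2 * D) := by
    have : (1 + c) * F ≤ (1 + c) * ((2 + 2 * c) * X - (1 + c) * D) := by gcongr
    nlinarith
  have hc1 : 0 ≤ c - 1 := sub_nonneg.2 hc
  have h6 : (1 + c) ^ 2 * ((2 - c) * (p * V)) ≤ 4 * (p * V) := by
    -- With d = c − 1 the left side is 4 − 3d² − d³; there is no linear term.
    have : (1 + c) ^ 2 * (2 - c) ≤ 4 := by 
      nlinarith [mul_nonneg hc1 hc1, mul_nonneg hc1 (mul_nonneg hc1 hc1)]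
    nlinarith
  have h7 : (2 - c) * (p * V) ≤ 4 * (4 * X - 2 * D) := by
    have hpos : 0 < (1 + c) ^ 2 := by positivity
    refine le_of_mul_le_mul_left ?_ hpos
    linarith
  linarith

end SampleGreedy

/-! ### Online simulation: the sample arrives first, but `Linear` sees it spread over a uniformly
random order. -/

namespace SampleGreedy

/-- The permutation that moves the positions in `B` to the front and keeps the order otherwise. -/
noncomputable def toFront {n : ℕ} (B : Finset (Fin n)) : Equiv.Perm (Fin n) :=
  (Tuple.sort fun i : Fin n => if i ∈ B then (i : ℕ) else n + i).symm

theorem toFront_lt {n : ℕ} {B : Finset (Fin n)} {i j : Fin n}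
    (h : (if i ∈ B then (i : ℕ) else n + i) < if j ∈ B then (j : ℕ) else n + j) :
    toFront B i < toFront B j := by
  have hm := Tuple.monotone_sort fun i : Fin n => if i ∈ B then (i : ℕ) else n + i
  by_contra! hle
  have := hm hle
  simp only [toFront, Function.comp_apply, Equiv.apply_symm_apply] at this
  exact absurd h (not_lt.2 this)

theorem toFront_lt_of_mem {n : ℕ} {B : Finset (Fin n)} {i j : Fin n} (hi : i ∈ B) (hj : j ∉ B) :
    toFront B i < toFront B j := by
  refine toFront_lt ?_
  rw [if_pos hi, if_neg hj]
  have := i.2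
  omega

/-- When the element at an unsampled simulated position arrives, all elements before it in the
simulated order have arrived, so the simulation can be run online. -/
theorem toFront_le_of_le {n : ℕ} {B : Finset (Fin n)} {i j : Fin n} (hij : i ≤ j) (hj : j ∉ B) :
    toFront B i ≤ toFront B j := by
  rcases hij.lt_or_eq with h | rfl
  · refine (toFront_lt ?_).le
    rw [if_neg hj]
    have := i.2
    have : (i : ℕ) < j := h
    split_ifs <;> omega
  · exact le_rfl

/-- The accuracy to which the algorithm rounds marginal values. -/
noncomputable def accuracy (n : ℕ) : ℝ := 1 + 1 / 4 ^ n

theorem one_lt_accuracy (n : ℕ) : 1 < accuracy n := by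
  unfold accuracy
  have : (0 : ℝ) < 1 / 4 ^ n := by positivity
  linarith

theorem accuracy_le_two (n : ℕ) : accuracy n ≤ 2 := by
  unfold accuracy
  have : (1 : ℝ) / 4 ^ n ≤ 1 := by
    rw [div_le_one (by positivity)]
    exact one_le_pow₀ (by norm_num)
  linarith

theorem accuracy_sub_one_mul_le (n : ℕ) : (accuracy n - 1) * (2 ^ n * n) ≤ 1 := by
  unfold accuracy
  have h : (n : ℝ) ≤ 2 ^ n := by exact_mod_cast Nat.lt_two_pow_self.le
  rw [add_sub_cancel_left, one_div_mul_eq_div, div_le_one (by positivity)]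
  calc (2 : ℝ) ^ n * n ≤ 2 ^ n * 2 ^ n := by gcongr
    _ = 4 ^ n := by rw [← mul_pow]; norm_num

/-- Rounding of marginal values, with a label to break ties. -/
noncomputable def rounding (n : ℕ) : Fin (n + 1) → ℝ → ℝ :=
  (exists_rounding n (one_lt_accuracy n)).choose

section ArrivedList

variable {U : Type u} {N : Matroid U} [N.Finite]

theorem coe_groundFinset : (groundFinset N : Set U) = N.E := Set.Finite.coe_toFinset _

theorem getElem?_arrivedList (σ : ArrivalOrder N) {j k : Fin (groundCard N)} (h : k ≤ j) :
    (arrivedList σ j)[(k : ℕ)]? = some (σ k : U) := by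
  have hk : (k : ℕ) < j + 1 := Nat.lt_succ_of_le h
  rw [arrivedList, List.getElem?_take, if_pos hk, List.getElem?_ofFn, dif_pos k.2]

theorem length_arrivedList (σ : ArrivalOrder N) (j : Fin (groundCard N)) :
    (arrivedList σ j).length = j + 1 := by
  rw [arrivedList, List.length_take, List.length_ofFn]
  have := j.2
  omega

theorem nodup_arrivedList (σ : ArrivalOrder N) (j : Fin (groundCard N)) :
    (arrivedList σ j).Nodup := by
  refine List.Nodup.sublist (List.take_sublist _ _) (List.nodup_ofFn.2 ?_)
  exact Subtype.val_injective.comp σ.injective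

theorem mem_arrivedList (σ : ArrivalOrder N) {j : Fin (groundCard N)} {u : U} :
    u ∈ arrivedList σ j ↔ ∃ k ≤ j, (σ k : U) = u := by
  constructor
  · intro h
    obtain ⟨k, hk, rfl⟩ := List.mem_iff_getElem.1 h
    rw [length_arrivedList] at hk
    have hkn : k < groundCard N := lt_of_lt_of_le hk j.2
    have hkj : (⟨k, hkn⟩ : Fin _) ≤ j := Nat.lt_succ_iff.1 hk
    refine ⟨⟨k, hkn⟩, hkj, ?_⟩
    have := getElem?_arrivedList σ hkj
    rw [List.getElem?_eq_some_iff] at this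
    exact this.choose_spec.symm
  · rintro ⟨k, hk, rfl⟩
    exact List.mem_of_getElem? (getElem?_arrivedList σ hk)

end ArrivedList

variable {U : Type u} [DecidableEq U]

omit [DecidableEq U] in
theorem isRoundingKey_rounding {n : ℕ} {E : Finset U} {t : U → Fin (n + 1)}
    (ht : Set.InjOn t E) : IsRoundingKey (fun u => rounding n (t u)) (accuracy n) E := by
  obtain ⟨h1, h2, h3, h4⟩ := (exists_rounding n (one_lt_accuracy n)).choose_spec
  exact ⟨fun u => h1 (t u), fun u => h2 (t u), fun u => h3 (t u),
    fun u hu v hv x y hx hxy => ht hu hv (h4 _ _ x y hx hxy)⟩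

section Algorithm

variable {n : ℕ}

/-- The elements that arrive at the first `i + 1` positions of the simulated order. -/
noncomputable def simulatedList (B : Finset (Fin n)) (l : List U) (i : Fin n) : List U :=
  ((List.finRange n).take (i + 1)).filterMap fun k => l[(toFront B k : ℕ)]?

open Classical in
/-- The sampled elements among those in `l`. -/
noncomputable def sampled (B : Finset (Fin n)) (l : List U) : Finset U :=
  l.toFinset.filter fun u => ∃ k ∈ B, l[(toFront B k : ℕ)]? = some u

/-- The label of an arrived element. -/
def arrivedLabel (p : Equiv.Perm (Fin n)) (l : List U) (u : U) : Fin (n + 1) :=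
  if h : l.idxOf u < n then (p ⟨l.idxOf u, h⟩).castSucc else Fin.last n

/-- The weight that the algorithm assigns to an arrived element. -/
noncomputable def onlineWeight (B : Finset (Fin n)) (p : Equiv.Perm (Fin n)) (l : List U)
    (f : Finset U → ℝ) (I : Finset U → Prop) (u : U) : ℝ :=
  weight f I (fun u => rounding n (arrivedLabel p l u)) (sampled B l) ∅ ∅
    (insert u (sampled B l)) u

/-- The decisions of the reduction. The permutation `toFront B` turns the arrival order into a
simulated order, which is presented to `A` together with the weights computed online, and in which
the elements at the positions in `B` are the sampled ones. -/
def acceptBy (A : OnlineAlgorithm.{u, v} U) (ω : A.Seed n) (B : Finset (Fin n))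
    (p : Equiv.Perm (Fin n)) (l : List U) (f : Finset U → ℝ) (I : Finset U → Prop) : Prop :=
  -- The length condition makes `i` the simulated position of the element that has just arrived.
  ∃ i : Fin n, i ∉ B ∧ (toFront B i : ℕ) + 1 = l.length ∧
    A.accept n ω (simulatedList B l i)
      (valueOracle (linearObjective (onlineWeight B p l f I)) (simulatedList B l i))
      (fun S => S ⊆ (simulatedList B l i).toFinset ∧ I S)

end Algorithm

section Arrival

variable {N : Matroid U} [N.Finite]

theorem idxOf_arrivedList (σ : ArrivalOrder N) {j k : Fin (groundCard N)} (h : k ≤ j) :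
    (arrivedList σ j).idxOf (σ k : U) = k := by
  obtain ⟨hk, e⟩ := List.getElem?_eq_some_iff.1 (getElem?_arrivedList σ h)
  conv_lhs => rw [← e]
  exact (nodup_arrivedList σ j).idxOf_getElem _ _

/-- The simulated order. -/
noncomputable def simulatedOrder (B : Finset (Fin (groundCard N))) (σ : ArrivalOrder N) :
    ArrivalOrder N :=
  (toFront B).trans σ

/-- The elements at the positions in `B`. -/
noncomputable def elementsAt (B : Finset (Fin (groundCard N))) (τ : ArrivalOrder N) : Finset U :=
  B.image fun k => (τ k : U)

/-- The key of an element, given the labels of the elements of the ground set. -/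
noncomputable def labelKey (t : groundFinset N ≃ Fin (groundCard N)) (u : U) : ℝ → ℝ :=
  rounding (groundCard N)
    (if h : u ∈ groundFinset N then (t ⟨u, h⟩).castSucc else Fin.last (groundCard N))

theorem isRoundingKey_labelKey (t : groundFinset N ≃ Fin (groundCard N)) :
    IsRoundingKey (labelKey t) (accuracy (groundCard N)) (groundFinset N) := by
  refine isRoundingKey_rounding ?_
  intro u hu w hw h
  simp only [Finset.mem_coe] at hu hw
  dsimp only at h
  rw [dif_pos hu, dif_pos hw] at h
  exact congrArg Subtype.val (t.injective (Fin.castSucc_injective _ h))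

/-- The weights presented to the algorithm for the matroid secretary problem. -/
noncomputable def offlineWeight (N : Matroid U) [N.Finite] (f : Finset U → ℝ)
    (t : groundFinset N ≃ Fin (groundCard N)) (L : Finset U) (u : U) : ℝ :=
  weight f (fun A => N.Indep (A : Set U)) (labelKey t) L ∅ ∅ (groundFinset N) u

omit [DecidableEq U] in
theorem simulatedList_arrivedList {B : Finset (Fin (groundCard N))} (σ : ArrivalOrder N)
    {i : Fin (groundCard N)} (hi : i ∉ B) :
    simulatedList B (arrivedList σ (toFront B i)) i = arrivedList (simulatedOrder B σ) i := by
  rw [arrivedList.eq_1 (simulatedOrder B σ), List.ofFn_eq_map, ← List.map_take, simulatedList,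
    ← List.filterMap_eq_map']
  refine List.filterMap_congr fun k hk => ?_
  have hki : k ≤ i := by
    obtain ⟨m, hm, rfl⟩ := List.mem_take_iff_getElem.1 hk
    rw [List.getElem_finRange, Fin.le_def]
    simp only [Fin.val_cast]
    omega
  rw [getElem?_arrivedList σ (toFront_le_of_le hki hi)]
  rfl

theorem elementsAt_subset_arrived {B : Finset (Fin (groundCard N))} (σ : ArrivalOrder N)
    {i : Fin (groundCard N)} (hi : i ∉ B) :
    elementsAt B (simulatedOrder B σ) ⊆ (arrivedList σ (toFront B i)).toFinset := by
  intro u hu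
  obtain ⟨k, hk, rfl⟩ := Finset.mem_image.1 hu
  rw [List.mem_toFinset, mem_arrivedList]
  exact ⟨_, (toFront_lt_of_mem hk hi).le, rfl⟩

theorem sampled_arrivedList {B : Finset (Fin (groundCard N))} (σ : ArrivalOrder N)
    {i : Fin (groundCard N)} (hi : i ∉ B) :
    sampled B (arrivedList σ (toFront B i)) = elementsAt B (simulatedOrder B σ) := by
  ext u
  rw [sampled, Finset.mem_filter]
  constructor
  · rintro ⟨-, k, hk, h⟩
    rw [getElem?_arrivedList σ (toFront_lt_of_mem hk hi).le, Option.some_inj] at h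
    exact Finset.mem_image.2 ⟨k, hk, h⟩
  · intro hu
    refine ⟨elementsAt_subset_arrived σ hi hu, ?_⟩
    obtain ⟨k, hk, rfl⟩ := Finset.mem_image.1 hu
    exact ⟨k, hk, getElem?_arrivedList σ (toFront_lt_of_mem hk hi).le⟩

theorem elementsAt_subset_ground (B : Finset (Fin (groundCard N))) (τ : ArrivalOrder N) :
    elementsAt B τ ⊆ groundFinset N := by
  intro u hu
  obtain ⟨k, -, rfl⟩ := Finset.mem_image.1 hu
  exact (τ k).2

/-- By `weight_local` the pass over the whole ground set may be cut down to the sample and `u`, all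
of which have arrived. Applying `p` to arrival indices produces the labels `σ.symm.trans p`. -/
theorem onlineWeight_arrivedList (f : Finset U → ℝ) {B : Finset (Fin (groundCard N))}
    (p : Equiv.Perm (Fin (groundCard N))) (σ : ArrivalOrder N) {i : Fin (groundCard N)}
    (hi : i ∉ B) {u : U} (hu : u ∈ arrivedList σ (toFront B i)) :
    onlineWeight B p (arrivedList σ (toFront B i)) (valueOracle f (arrivedList σ (toFront B i)))
      (indepOracle N (arrivedList σ (toFront B i))) u =
    offlineWeight N f (σ.symm.trans p) (elementsAt B (simulatedOrder B σ)) u := by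
  have huE : u ∈ groundFinset N := by
    obtain ⟨k, -, rfl⟩ := (mem_arrivedList σ).1 hu
    exact (σ k).2
  rw [onlineWeight, sampled_arrivedList σ hi, offlineWeight,
    weight_local (isRoundingKey_labelKey _).injOn huE ∅,
    Finset.inter_eq_right.2 (elementsAt_subset_ground B _)]
  have hE0 := Finset.empty_subset (arrivedList σ (toFront B i)).toFinset
  have hf : ∀ A ⊆ (arrivedList σ (toFront B i)).toFinset,
      valueOracle f (arrivedList σ (toFront B i)) A = f A := fun A hA => if_pos hA
  have hk : ∀ w ∈ (arrivedList σ (toFront B i)).toFinset,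
      rounding (groundCard N) (arrivedLabel p (arrivedList σ (toFront B i)) w) =
        labelKey (σ.symm.trans p) w := by
    intro w hw
    obtain ⟨k, hk, rfl⟩ := (mem_arrivedList σ).1 (List.mem_toFinset.1 hw)
    rw [arrivedLabel, labelKey, dif_pos (σ k).2]
    simp only [idxOf_arrivedList σ hk, k.2, dif_pos, Equiv.trans_apply, Subtype.coe_eta,
      Equiv.symm_apply_apply, Fin.eta]
  refine total_congr_oracle (A := (arrivedList σ (toFront B i)).toFinset) hf
    (fun A hA => and_iff_right hA) hk (fun _ _ _ _ _ _ => rfl) ?_ hE0 hE0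
    (Finset.insert_subset (List.mem_toFinset.2 hu) (elementsAt_subset_arrived σ hi))
  intro M S x hM _ hx
  split_ifs
  · dsimp only
    rw [hk x hx, hf _ hM, hf _ (Finset.insert_subset hx hM)]
  · rfl

theorem valueOracle_linearObjective_congr {w w' : U → ℝ} {l : List U}
    (h : ∀ u ∈ l, w u = w' u) :
    valueOracle (linearObjective w) l = valueOracle (linearObjective w') l := by
  funext S
  unfold valueOracle linearObjective
  split_ifs with hS
  · exact Finset.sum_congr rfl fun u hu => h u (List.mem_toFinset.1 (hS hu))
  · rfl

omit [DecidableEq U] in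
theorem mem_arrivedList_of_mem_simulated {B : Finset (Fin (groundCard N))} (σ : ArrivalOrder N)
    {i : Fin (groundCard N)} (hi : i ∉ B) {u : U}
    (hu : u ∈ arrivedList (simulatedOrder B σ) i) : u ∈ arrivedList σ (toFront B i) := by
  obtain ⟨k, hk, rfl⟩ := (mem_arrivedList _).1 hu
  exact (mem_arrivedList σ).2 ⟨_, toFront_le_of_le hk hi, rfl⟩

theorem acceptBy_arrivedList (A : OnlineAlgorithm.{u, v} U) (f : Finset U → ℝ)
    (ω : A.Seed (groundCard N)) (B : Finset (Fin (groundCard N)))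
    (p : Equiv.Perm (Fin (groundCard N))) (σ : ArrivalOrder N) (i : Fin (groundCard N)) :
    acceptBy A ω B p (arrivedList σ (toFront B i))
      (valueOracle f (arrivedList σ (toFront B i)))
      (indepOracle N (arrivedList σ (toFront B i))) ↔
    i ∉ B ∧ A.accept (groundCard N) ω (arrivedList (simulatedOrder B σ) i)
      (valueOracle (linearObjective
        (offlineWeight N f (σ.symm.trans p) (elementsAt B (simulatedOrder B σ))))
        (arrivedList (simulatedOrder B σ) i))
      (indepOracle N (arrivedList (simulatedOrder B σ) i)) := by
  have hstep : ∀ i' : Fin (groundCard N),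
      (toFront B i' : ℕ) + 1 = (arrivedList σ (toFront B i)).length ↔ i' = i := by
    intro i'
    rw [length_arrivedList, add_left_inj, Fin.val_inj, (toFront B).apply_eq_iff_eq]
  have hI : i ∉ B → (fun S => S ⊆ (arrivedList (simulatedOrder B σ) i).toFinset ∧
      indepOracle N (arrivedList σ (toFront B i)) S) =
        indepOracle N (arrivedList (simulatedOrder B σ) i) := by
    intro hi
    funext S
    refine propext (and_congr_right fun hS => and_iff_right fun u hu => ?_)
    exact List.mem_toFinset.2
      (mem_arrivedList_of_mem_simulated σ hi (List.mem_toFinset.1 (hS hu)))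
  have hv := fun hi : i ∉ B => valueOracle_linearObjective_congr
    fun u hu => onlineWeight_arrivedList f p σ hi (mem_arrivedList_of_mem_simulated σ hi hu)
  unfold acceptBy
  simp only [hstep]
  constructor
  · rintro ⟨i', hi, rfl, h⟩
    rw [simulatedList_arrivedList σ hi, hI hi, hv hi] at h
    exact ⟨hi, h⟩
  · rintro ⟨hi, h⟩
    refine ⟨i, hi, rfl, ?_⟩
    rw [simulatedList_arrivedList σ hi, hI hi, hv hi]
    exact h

end Arrival

end SampleGreedy

/-! ### The reduction and its expected value. -/

namespace SampleGreedy

/-- The coins of the reduction: the sampled positions, and the labels in order of arrival. -/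
def Coins (n : ℕ) : Type v := ULift.{v} (Finset (Fin n) × Equiv.Perm (Fin n))

instance (n : ℕ) : Fintype (Coins.{v} n) :=
  inferInstanceAs (Fintype (ULift.{v} (Finset (Fin n) × Equiv.Perm (Fin n))))

instance (n : ℕ) : Nonempty (Coins.{v} n) :=
  inferInstanceAs (Nonempty (ULift.{v} (Finset (Fin n) × Equiv.Perm (Fin n))))

instance (n : ℕ) : MeasurableSpace (Coins.{v} n) := ⊤

instance (n : ℕ) : DiscreteMeasurableSpace (Coins.{v} n) := ⟨fun _ => trivial⟩

variable {U : Type u} [DecidableEq U]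

/-- The reduction from the monotone submodular matroid secretary problem to the matroid secretary
problem. -/
noncomputable def reduction (A : OnlineAlgorithm.{u, v} U) : OnlineAlgorithm.{u, v} U where
  Seed n := A.Seed n × Coins.{v} n
  seedSpace _ := inferInstance
  law n := (A.law n).prod (PMF.uniformOfFintype (Coins.{v} n)).toMeasure
  law_prob _ := inferInstance
  accept _ s l f I := acceptBy A s.1 s.2.down.1 s.2.down.2 l f I
  measurableSet_accept n l f I := by
    have h : {s : A.Seed n × Coins.{v} n | acceptBy A s.1 s.2.down.1 s.2.down.2 l f I} =
        ⋃ x : Coins.{v} n, {ω | acceptBy A ω x.down.1 x.down.2 l f I} ×ˢ {x} := by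
      ext s
      simp [Set.mem_iUnion]
    rw [h]
    refine MeasurableSet.iUnion fun x => MeasurableSet.prod ?_ (MeasurableSet.singleton x)
    have h' : {ω | acceptBy A ω x.down.1 x.down.2 l f I} =
        ⋃ i : Fin n, {ω | i ∉ x.down.1 ∧ (toFront x.down.1 i : ℕ) + 1 = l.length ∧
          A.accept n ω (simulatedList x.down.1 l i)
          (valueOracle (linearObjective (onlineWeight x.down.1 x.down.2 l f I))
            (simulatedList x.down.1 l i))
          (fun S => S ⊆ (simulatedList x.down.1 l i).toFinset ∧ I S)} := by
      ext ω
      simp [acceptBy]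
    rw [h']
    refine MeasurableSet.iUnion fun i => ?_
    exact (MeasurableSet.const _).inter
      ((MeasurableSet.const _).inter (A.measurableSet_accept _ _ _ _))

section Output

variable {N : Matroid U} [N.Finite]

theorem mem_output {A : OnlineAlgorithm.{u, v} U} {f : Finset U → ℝ} {σ : ArrivalOrder N}
    {ω : A.Seed (groundCard N)} {u : U} : u ∈ A.output N f σ ω ↔ ∃ i, A.accept (groundCard N) ω
      (arrivedList σ i) (valueOracle f (arrivedList σ i)) (indepOracle N (arrivedList σ i)) ∧
        (σ i : U) = u := by
  simp [OnlineAlgorithm.output]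

theorem output_subset (A : OnlineAlgorithm.{u, v} U) (f : Finset U → ℝ) (σ : ArrivalOrder N)
    (ω : A.Seed (groundCard N)) : A.output N f σ ω ⊆ groundFinset N := by
  intro u hu
  obtain ⟨i, -, rfl⟩ := mem_output.1 hu
  exact (σ i).2

/-- The reduction accepts the elements accepted by `A` that are not sampled. -/
theorem output_reduction (A : OnlineAlgorithm.{u, v} U) (f : Finset U → ℝ) (σ : ArrivalOrder N)
    (ω : A.Seed (groundCard N)) (x : Coins.{v} (groundCard N)) :
    (reduction A).output N f σ (ω, x) =
      A.output N (linearObjective (offlineWeight N f (σ.symm.trans x.down.2)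
        (elementsAt x.down.1 (simulatedOrder x.down.1 σ)))) (simulatedOrder x.down.1 σ) ω \
        elementsAt x.down.1 (simulatedOrder x.down.1 σ) := by
  have hmem : ∀ i, (simulatedOrder x.down.1 σ i : U) ∈
      elementsAt x.down.1 (simulatedOrder x.down.1 σ) ↔ i ∈ x.down.1 := by
    intro i
    rw [elementsAt, Finset.mem_image]
    constructor
    · rintro ⟨k, hk, h⟩
      rwa [← (simulatedOrder x.down.1 σ).injective (Subtype.ext h)]
    · exact fun hi => ⟨i, hi, rfl⟩
  ext u
  rw [Finset.mem_sdiff, mem_output]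
  refine (mem_output (A := reduction A)).trans ?_
  constructor
  · rintro ⟨j, h, rfl⟩
    obtain ⟨i, rfl⟩ := (toFront x.down.1).surjective j
    obtain ⟨hi, h⟩ := (acceptBy_arrivedList A f ω x.down.1 x.down.2 σ i).1 h
    exact ⟨⟨i, h, rfl⟩, fun hu => hi ((hmem i).1 hu)⟩
  · rintro ⟨⟨i, h, rfl⟩, hu⟩
    exact ⟨toFront x.down.1 i, (acceptBy_arrivedList A f ω x.down.1 x.down.2 σ i).2
      ⟨fun hi => hu ((hmem i).2 hi), h⟩, rfl⟩

/-- Every function of the set of accepted elements is a measurable function of finitely many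
decisions. -/
theorem measurable_output (A : OnlineAlgorithm.{u, v} U) (f : Finset U → ℝ) (σ : ArrivalOrder N) :
    ∃ (d : A.Seed (groundCard N) → Fin (groundCard N) → Prop)
      (g : (Fin (groundCard N) → Prop) → Finset U),
      Measurable d ∧ ∀ ω, A.output N f σ ω = g (d ω) := by
  classical
  refine ⟨fun ω i => A.accept (groundCard N) ω (arrivedList σ i)
    (valueOracle f (arrivedList σ i)) (indepOracle N (arrivedList σ i)),
    fun d => (Finset.univ.filter fun i => d i).image fun i => (σ i : U), ?_, fun ω => ?_⟩
  · exact measurable_pi_lambda _ fun i => measurableSet_setOfPred.1 (A.measurableSet_accept _ _ _ _)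
  · ext u
    simp [mem_output]

theorem measurableSet_mem_output (A : OnlineAlgorithm.{u, v} U) (f : Finset U → ℝ)
    (σ : ArrivalOrder N) (u : U) : MeasurableSet {ω | u ∈ A.output N f σ ω} := by
  obtain ⟨d, g, hd, h⟩ := measurable_output A f σ
  simp_rw [h]
  exact hd (MeasurableSet.of_discrete (s := {p | u ∈ g p}))

theorem integrable_output (A : OnlineAlgorithm.{u, v} U) (f : Finset U → ℝ) (σ : ArrivalOrder N)
    (h : Finset U → ℝ) :
    Integrable (fun ω => h (A.output N f σ ω)) (A.law (groundCard N)) := by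
  obtain ⟨d, g, hd, hg⟩ := measurable_output A f σ
  simp_rw [hg]
  have : IsFiniteMeasure ((A.law (groundCard N)).map d) := Measure.isFiniteMeasure_map _ _
  exact (Integrable.of_finite (f := fun p => h (g p))
    (μ := (A.law (groundCard N)).map d)).comp_measurable hd

theorem integral_output_reduction (A : OnlineAlgorithm.{u, v} U) (f : Finset U → ℝ)
    (σ : ArrivalOrder N) :
    ∫ s, f ((reduction A).output N f σ s) ∂((reduction A).law (groundCard N)) =
      (∑ x : Coins.{v} (groundCard N),
        ∫ ω, f ((reduction A).output N f σ (ω, x)) ∂(A.law (groundCard N))) /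
          Fintype.card (Coins.{v} (groundCard N)) := by
  have hint := integrable_output (reduction A) f σ f
  refine (integral_prod_symm (fun s => f ((reduction A).output N f σ s)) hint).trans ?_
  rw [PMF.integral_eq_sum, Finset.sum_div]
  refine Finset.sum_congr rfl fun x _ => ?_
  rw [PMF.uniformOfFintype_apply, ENNReal.toReal_inv, ENNReal.toReal_natCast, smul_eq_mul,
    inv_mul_eq_div]

end Output

section Value

variable {N : Matroid U} [N.Finite] {f : Finset U → ℝ}

/-- The contribution of an element of the ground set. -/
noncomputable def offlineGain (N : Matroid U) [N.Finite] (f : Finset U → ℝ)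
    (t : groundFinset N ≃ Fin (groundCard N)) (L : Finset U) (u : U) : ℝ :=
  gain f (fun A => N.Indep (A : Set U)) (labelKey t) L ∅ ∅ (groundFinset N) u

theorem offlineGain_nonneg (hf : IsMSMSPObjective N f)
    (t : groundFinset N ≃ Fin (groundCard N)) (L : Finset U) (u : U) :
    0 ≤ offlineGain N f t L u :=
  gain_nonneg (hf.monoSubmodularOn coe_groundFinset) (Finset.empty_subset _)
    (Finset.empty_subset _) subset_rfl u

theorem isMSPWeight_offlineWeight (t : groundFinset N ≃ Fin (groundCard N)) (L : Finset U) :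
    IsMSPWeight N (offlineWeight N f t L) := fun _ _ => weight_nonneg _

/-- An element with non-zero gain lies in every optimal solution, hence in the random one with
probability 1, whichever random solution is provided. -/
theorem offlineGain_div_le_selectProb (hf : IsMSMSPObjective N f) {A : OnlineAlgorithm.{u, v} U}
    {α : ℝ} (hA : SelectsOptimalElementsOn A α N)
    (t : groundFinset N ≃ Fin (groundCard N)) (L : Finset U) {u : U} (hu : u ∈ groundFinset N) :
    offlineGain N f t L u / α ≤ offlineGain N f t L u *
      A.selectProb N (linearObjective (offlineWeight N f t L)) u := by
  by_cases h0 : offlineGain N f t L u = 0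
  · rw [h0, zero_div, zero_mul]
  obtain ⟨S, hS, hsel⟩ := hA _ (isMSPWeight_offlineWeight t L)
  have huN : u ∈ N.E := by rw [← coe_groundFinset]; exact Finset.mem_coe.2 hu
  have hpos : 0 < offlineWeight N f t L u := weight_pos_of_gain_ne_zero h0
  have hkey := isRoundingKey_labelKey t
  have hmem : ∀ T ∈ S.support, u ∈ T := by
    intro T hT
    refine mem_of_isOptimalSolution ?_ huN hpos ?_ (hS T hT)
    · intro w hw hwu
      have hw' : w ∈ groundFinset N := by
        rw [← coe_groundFinset] at hw
        exact Finset.mem_coe.1 hw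
      obtain ⟨x, hx⟩ := weight_eq_key hpos
      obtain ⟨y, hy⟩ := weight_eq_key (hpos.trans_eq hwu.symm)
      refine hkey.injOn w hw' u hu y x ?_ ?_
      · exact hy ▸ hpos.trans_eq hwu.symm
      · exact (hy.symm.trans hwu).trans hx
    · have := notMem_closure_of_gain_ne_zero coe_groundFinset
        (hf.monoSubmodularOn coe_groundFinset) hkey.monotone (Finset.empty_subset _)
        subset_rfl (by simp) h0
      simpa [offlineWeight] using this
  have h1 : S.toOuterMeasure {T | u ∈ T} = 1 := (S.toOuterMeasure_apply_eq_one_iff _).2 hmem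
  have h2 := hsel u huN
  rw [h1, ENNReal.toReal_one] at h2
  rw [div_eq_mul_one_div]
  exact mul_le_mul_of_nonneg_left h2 (offlineGain_nonneg hf t L u)

/-- The elements accepted from a simulated order have at least the value of their contributions. -/
theorem le_integral_output_sdiff (hf : IsMSMSPObjective N f) (A : OnlineAlgorithm.{u, v} U)
    (t : groundFinset N ≃ Fin (groundCard N)) (L : Finset U) (w : Finset U → ℝ)
    (τ : ArrivalOrder N) :
    f ∅ + ∑ u ∈ groundFinset N, offlineGain N f t L u *
        (A.law (groundCard N)).real {ω | u ∈ A.output N w τ ω} ≤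
      ∫ ω, f (A.output N w τ ω \ L) ∂(A.law (groundCard N)) := by
  classical
  have h1 : ∀ u, ∫ ω, (if u ∈ A.output N w τ ω then offlineGain N f t L u else 0)
      ∂(A.law (groundCard N)) = offlineGain N f t L u *
        (A.law (groundCard N)).real {ω | u ∈ A.output N w τ ω} := by
    intro u
    have := integral_indicator_const (μ := A.law (groundCard N)) (offlineGain N f t L u)
      (measurableSet_mem_output A w τ u)
    rw [smul_eq_mul, mul_comm] at this
    rw [← this]
    refine integral_congr_ae (ae_of_all _ fun ω => ?_)
    by_cases hω : u ∈ A.output N w τ ω <;> simp [hω]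
  have hint : ∀ u, Integrable (fun ω => if u ∈ A.output N w τ ω then offlineGain N f t L u else 0)
      (A.law (groundCard N)) := fun u =>
    integrable_output A w τ fun Q => if u ∈ Q then offlineGain N f t L u else 0
  have h2 : f ∅ + ∑ u ∈ groundFinset N, offlineGain N f t L u *
        (A.law (groundCard N)).real {ω | u ∈ A.output N w τ ω} =
      ∫ ω, (f ∅ + ∑ u ∈ groundFinset N,
        if u ∈ A.output N w τ ω then offlineGain N f t L u else 0) ∂(A.law (groundCard N)) := by
    rw [integral_add (integrable_const _) (integrable_finsetSum _ fun u _ => hint u),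
      integral_finsetSum _ fun u _ => hint u]
    simp [h1]
  rw [h2]
  refine integral_mono
    ((integrable_const _).add (integrable_finsetSum _ fun u _ => hint u))
    (integrable_output A w τ fun Q => f (Q \ L)) fun ω => ?_
  have hQ := output_subset A w τ ω
  set Q := A.output N w τ ω
  have h3 := sum_gain_le (I := fun A => N.Indep (A : Set U)) (key := labelKey t) (L := L)
    (hf.monoSubmodularOn coe_groundFinset) (Finset.empty_subset (groundFinset N))
    (Finset.empty_subset _) (subset_refl (groundFinset N)) (Q \ L)
  rw [Finset.empty_union, Finset.inter_eq_left.2 (Finset.sdiff_subset.trans hQ)] at h3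
  have h4 : ∑ u ∈ groundFinset N, (if u ∈ Q then offlineGain N f t L u else 0) =
      ∑ u ∈ Q \ L, offlineGain N f t L u := by
    -- Sampled elements have gain 0, so removing `L` from the output loses no contribution.
    rw [Finset.sum_ite_mem, Finset.inter_eq_right.2 hQ]
    refine (Finset.sum_subset Finset.sdiff_subset fun u huQ hu => ?_).symm
    exact gain_eq_zero fun _ => by_contra fun huL => hu (Finset.mem_sdiff.2 ⟨huQ, huL⟩)
  dsimp only
  rw [h4]
  unfold offlineGain
  linarith

/-- Summing over arrival orders, samples and labels is the same for the arrival order and for the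
simulated order. -/
theorem sum_arrival_eq_sum_simulated
    (H : ArrivalOrder N → Finset U → (groundFinset N ≃ Fin (groundCard N)) → ℝ) :
    ∑ σ : ArrivalOrder N, ∑ x : Coins.{v} (groundCard N),
      H (simulatedOrder x.down.1 σ) (elementsAt x.down.1 (simulatedOrder x.down.1 σ))
        (σ.symm.trans x.down.2) =
    ∑ t : groundFinset N ≃ Fin (groundCard N), ∑ L ∈ (groundFinset N).powerset,
      ∑ τ : ArrivalOrder N, H τ L t := by
  have h1 : ∀ σ : ArrivalOrder N, ∑ x : Coins.{v} (groundCard N),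
      H (simulatedOrder x.down.1 σ) (elementsAt x.down.1 (simulatedOrder x.down.1 σ))
        (σ.symm.trans x.down.2) =
      ∑ B : Finset (Fin (groundCard N)), ∑ t : groundFinset N ≃ Fin (groundCard N),
        H (simulatedOrder B σ) (elementsAt B (simulatedOrder B σ)) t := by
    intro σ
    -- For fixed `σ` the map `p ↦ σ.symm.trans p` is a bijection. The random `p` thus makes the
    -- labels, and with them the weights, independent of the order, as the hypothesis on `A`
    -- requires.
    rw [← Fintype.sum_prod_type']
    refine Fintype.sum_equiv (Equiv.ulift.trans (Equiv.prodCongr (Equiv.refl _)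
      (Equiv.equivCongr σ (Equiv.refl _)))) _ _ fun x => ?_
    rfl
  have h2 : ∀ τ : ArrivalOrder N, ∀ t, ∑ B : Finset (Fin (groundCard N)), H τ (elementsAt B τ) t =
      ∑ L ∈ (groundFinset N).powerset, H τ L t := by
    intro τ t
    refine Finset.sum_bij (fun B _ => elementsAt B τ) ?_ ?_ ?_ fun _ _ => rfl
    · intro B _
      exact Finset.mem_powerset.2 (elementsAt_subset_ground B τ)
    · intro B _ B' _ h
      exact Finset.image_injective (Subtype.val_injective.comp τ.injective) h
    · intro L hL
      refine ⟨Finset.univ.filter fun i => (τ i : U) ∈ L, Finset.mem_univ _, ?_⟩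
      ext u
      simp only [elementsAt, Finset.mem_image, Finset.mem_filter, Finset.mem_univ, true_and]
      constructor
      · rintro ⟨k, hk, rfl⟩
        exact hk
      · intro hu
        exact ⟨τ.symm ⟨u, Finset.mem_powerset.1 hL hu⟩, by simpa using hu, by simp⟩
  calc _ = ∑ σ : ArrivalOrder N, ∑ B : Finset (Fin (groundCard N)), ∑ t,
        H (simulatedOrder B σ) (elementsAt B (simulatedOrder B σ)) t :=
        Finset.sum_congr rfl fun σ _ => h1 σ
    _ = ∑ B : Finset (Fin (groundCard N)), ∑ τ : ArrivalOrder N, ∑ t,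
        H τ (elementsAt B τ) t := by
        rw [Finset.sum_comm]
        refine Finset.sum_congr rfl fun B _ => ?_
        exact Fintype.sum_equiv (Equiv.equivCongr (toFront B).symm (Equiv.refl _)) _ _ fun σ => rfl
    _ = ∑ τ : ArrivalOrder N, ∑ t, ∑ B : Finset (Fin (groundCard N)), H τ (elementsAt B τ) t := by
        rw [Finset.sum_comm]
        exact Finset.sum_congr rfl fun τ _ => Finset.sum_comm
    _ = ∑ τ : ArrivalOrder N, ∑ t, ∑ L ∈ (groundFinset N).powerset, H τ L t := by
        simp_rw [h2]
    _ = _ := by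
        rw [Finset.sum_comm]
        exact Finset.sum_congr rfl fun t _ => Finset.sum_comm

theorem expectedValue_reduction_ge (hf : IsMSMSPObjective N f) {A : OnlineAlgorithm.{u, v} U}
    {α : ℝ} (hα : 1 ≤ α) (hA : SelectsOptimalElementsOn A α N) {T : Finset U}
    (hT : N.Indep (T : Set U)) :
    f ∅ + (f T - f ∅) / (16 * α) ≤ (reduction A).expectedValue N f := by
  have hα0 : 0 < α := one_pos.trans_le hα
  let H : ArrivalOrder N → Finset U → (groundFinset N ≃ Fin (groundCard N)) → ℝ := fun τ L t =>
    f ∅ + ∑ u ∈ groundFinset N, offlineGain N f t L u * (A.law (groundCard N)).real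
      {ω | u ∈ A.output N (linearObjective (offlineWeight N f t L)) τ ω}
  have hK : 0 < (Fintype.card (ArrivalOrder N) : ℝ) := by
    have : Nonempty (ArrivalOrder N) := ⟨(groundFinset N).equivFin.symm⟩
    exact_mod_cast Fintype.card_pos
  have hC : 0 < (Fintype.card (Coins.{v} (groundCard N)) : ℝ) := by
    exact_mod_cast Fintype.card_pos
  have h1 : (∑ σ : ArrivalOrder N, ∑ x : Coins.{v} (groundCard N),
      H (simulatedOrder x.down.1 σ) (elementsAt x.down.1 (simulatedOrder x.down.1 σ))
        (σ.symm.trans x.down.2)) / Fintype.card (Coins.{v} (groundCard N)) /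
          Fintype.card (ArrivalOrder N) ≤ (reduction A).expectedValue N f := by
    rw [OnlineAlgorithm.expectedValue, Fintype.expect_eq_sum_div_card, Finset.sum_div]
    gcongr with σ _
    rw [integral_output_reduction]
    gcongr with x _
    simp_rw [output_reduction]
    exact le_integral_output_sdiff hf A _ _ _ _
  refine le_trans ?_ h1
  rw [sum_arrival_eq_sum_simulated, div_div, le_div_iff₀ (mul_pos hC hK)]
  have h2 : ∀ t : groundFinset N ≃ Fin (groundCard N),
      (Fintype.card (ArrivalOrder N) : ℝ) * 2 ^ groundCard N *
        (f ∅ + (f T - f ∅) / (16 * α)) ≤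
      ∑ L ∈ (groundFinset N).powerset, ∑ τ : ArrivalOrder N, H τ L t := by
    intro t
    have h3 : ∀ L ∈ (groundFinset N).powerset,
        (Fintype.card (ArrivalOrder N) : ℝ) *
          (f ∅ + (∑ u ∈ groundFinset N, offlineGain N f t L u) / α) ≤
        ∑ τ : ArrivalOrder N, H τ L t := by
      intro L _
      -- For fixed sample and labels the weights are fixed, so averaging over `τ` yields the
      -- selection probabilities of `A`.
      have h4 : ∑ τ : ArrivalOrder N, H τ L t = (Fintype.card (ArrivalOrder N) : ℝ) *
          (f ∅ + ∑ u ∈ groundFinset N, offlineGain N f t L u *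
            A.selectProb N (linearObjective (offlineWeight N f t L)) u) := by
        simp only [H]
        rw [Finset.sum_add_distrib, Finset.sum_const, Finset.card_univ, nsmul_eq_mul,
          Finset.sum_comm, mul_add, Finset.mul_sum]
        congr 1
        refine Finset.sum_congr rfl fun u _ => ?_
        rw [← Finset.mul_sum, OnlineAlgorithm.selectProb, Fintype.expect_eq_sum_div_card]
        field_simp
      rw [h4, Finset.sum_div]
      gcongr with u hu
      exact offlineGain_div_le_selectProb hf hA t L hu
    refine le_trans ?_ (Finset.sum_le_sum h3)
    rw [← Finset.mul_sum, Finset.sum_add_distrib, Finset.sum_const, Finset.card_powerset,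
      ← Finset.sum_div, nsmul_eq_mul, mul_assoc]
    refine mul_le_mul_of_nonneg_left ?_ hK.le
    have h5 := sum_gain_ge coe_groundFinset (hf.monoSubmodularOn coe_groundFinset)
      (isRoundingKey_labelKey t) (one_lt_accuracy _).le (accuracy_le_two _)
      (accuracy_sub_one_mul_le (groundCard N)) hT
    have h6 : (2 : ℝ) ^ groundCard N * ((f T - f ∅) / (16 * α)) ≤
        (∑ L ∈ (groundFinset N).powerset, ∑ u ∈ groundFinset N, offlineGain N f t L u) / α := by
      rw [← mul_div_assoc, div_le_div_iff₀ (by positivity) hα0]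
      calc _ ≤ (16 * ∑ L ∈ (groundFinset N).powerset,
            ∑ u ∈ groundFinset N, offlineGain N f t L u) * α :=
            mul_le_mul_of_nonneg_right h5 hα0.le
        _ = _ := by ring
    rw [mul_add]
    push_cast
    exact add_le_add le_rfl h6
  have h7 : Fintype.card (Coins.{v} (groundCard N)) =
      2 ^ groundCard N * Fintype.card (groundFinset N ≃ Fin (groundCard N)) := by
    have h8 : Fintype.card (groundFinset N ≃ Fin (groundCard N)) =
        Fintype.card (Equiv.Perm (Fin (groundCard N))) :=
      Fintype.card_congr (Equiv.equivCongr (groundFinset N).equivFin (Equiv.refl _))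
    rw [h8, Fintype.card_congr (show Coins.{v} (groundCard N) ≃
      Finset (Fin (groundCard N)) × Equiv.Perm (Fin (groundCard N)) from Equiv.ulift), Fintype.card_prod,
      Fintype.card_finset, Fintype.card_fin]
  refine le_trans (le_of_eq ?_) (Finset.card_nsmul_le_sum Finset.univ _ _ fun t _ => h2 t)
  rw [h7, nsmul_eq_mul, Finset.card_univ]
  push_cast
  ring

end Value

end SampleGreedy

theorem theorem5 {U : Type u} [DecidableEq U] (Linear : OnlineAlgorithm.{u, v} U)
    (hLinear : IsMSPAlgorithm Linear) (α : ℝ) (hα : 1 ≤ α) :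
    ∃ A : OnlineAlgorithm.{u, v} U, IsMSMSPAlgorithm A ∧
      ∀ (M : Matroid U) [M.Finite], SelectsOptimalElementsOn Linear α M →
        IsMSMSPCompetitiveOn A (16 * α) M := by
  refine ⟨SampleGreedy.reduction Linear, ?_, ?_⟩
  · rintro M _ f hf σ ⟨ω, x⟩
    rw [SampleGreedy.output_reduction]
    exact (hLinear M _ (SampleGreedy.isMSPWeight_offlineWeight _ _) _ ω).subset
      (Finset.coe_subset.2 Finset.sdiff_subset)
  · intro M _ hsel f hf T hT
    refine le_trans ?_ (SampleGreedy.expectedValue_reduction_ge hf hα hsel hT)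
    have h0 : 0 ≤ f ∅ := hf.nonneg ∅ (by simp)
    -- The bound for the reduction keeps `f ∅` undivided, so non-negativity of `f ∅` finishes the
    -- proof.
    have h1 : f ∅ / (16 * α) ≤ f ∅ := div_le_self h0 (by linarith)
    rw [one_div_mul_eq_div, sub_div]
    linarith
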